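/- Let $G$ be a finite group. A sequence over $G$ is a finite unordered sequence of terms from $G$ with repetition allowed, that is, an element of the free abelian monoid $\mathcal F(G)$ with basis $G$; its length is the number of its terms, counted with multiplicity. A sequence is a product-one sequence if its terms can be ordered so that their product is $1_G$ (the empty sequence is one), and it is product-one free if none of its nonempty subsequences is a product-one sequence. The product-one sequences form a submonoid $\mathcal B(G)$ of $\mathcal F(G)$. The large Davenport constant $\mathsf D(G)$ is the supremum of the lengths of the atoms (irreducible elements) of $\mathcal B(G)$, and the small Davenport constant $\mathsf d(G)$ is the supremum of the lengths of the product-one free sequences over $G$. Write $C_n$ for the cyclic group of order $n$, $D_{2n}$ for the dihedral group of order $2n$, and $Q_8$ for the quaternion group of order $8$. 1. If $|G| \ge 32$, then either $G \cong C_2^5$ and $\mathsf d(G) = 5$, or else $\mathsf d(G) \ge 6$. 2. $\mathsf D(G) = 6$ if and only if $G$ is isomorphic to one of the groups $C_6$, $C_2 \oplus C_2 \oplus C_4$, $C_2^5$, $D_6$, $Q_8$, $D_8$. 3. If $\mathsf D(G) \le 5$, then $G$ is abelian. -/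

import Mathlib

/-! Sequences over a group `G` are finite unordered sequences of terms from `G` with repetition
allowed, i.e. elements of the free abelian monoid with basis `G`. They are modelled by
`Multiset G`, so the monoid operation is written additively, the empty sequence is `0`, the
length is `Multiset.card` and "is a subsequence of" is `≤`. -/

namespace GroupSequence

/-- The set of products `π(S)`: all products of the terms of `S`, over all orderings of these
terms. For the empty sequence this is `{1}`. -/
def products {G : Type*} [Group G] (S : Multiset G) : Set G :=
  {g | ∃ l : List G, (l : Multiset G) = S ∧ l.prod = g}

/-- The set of subsequence products `Π(S)`: the union of all `π(T)`, where `T` runs over the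
nonempty subsequences of `S`. -/
def subproducts {G : Type*} [Group G] (S : Multiset G) : Set G :=
  {g | ∃ T : Multiset G, T ≤ S ∧ 1 ≤ Multiset.card T ∧ g ∈ products T}

/-- The terms of `S` can be ordered such that their product is the identity. -/
def IsProductOne {G : Type*} [Group G] (S : Multiset G) : Prop :=
  1 ∈ products S

/-- No nonempty subsequence of `S` is a product-one sequence. -/
def IsProductOneFree {G : Type*} [Group G] (S : Multiset G) : Prop :=
  1 ∉ subproducts S

/-- The monoid `𝓑(G)` of product-one sequences over `G`. -/
def productOneMonoid (G : Type*) [Group G] : AddSubmonoid (Multiset G) where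
  carrier := {S | IsProductOne S}
  zero_mem' := ⟨[], rfl, rfl⟩
  add_mem' := by
    rintro S T ⟨l, rfl, hl⟩ ⟨m, rfl, hm⟩
    exact ⟨l ++ m, (Multiset.coe_add l m).symm, by rw [List.prod_append, hl, hm, one_mul]⟩

/-- The large Davenport constant `D(G)`: the supremum of the lengths of the atoms (irreducible
elements) of the monoid `𝓑(G)`. -/
noncomputable def largeDavenport (G : Type*) [Group G] : ℕ∞ :=
  ⨆ S ∈ {S : productOneMonoid G | AddIrreducible S}, (Multiset.card (S : Multiset G) : ℕ∞)

/-- The small Davenport constant `d(G)`: the supremum of the lengths of the product-one free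
sequences over `G`. -/
noncomputable def smallDavenport (G : Type*) [Group G] : ℕ∞ :=
  ⨆ S ∈ {S : Multiset G | IsProductOneFree S}, (Multiset.card S : ℕ∞)

/-- The cyclic group `C_n` of order `n` (for `n ≥ 1`), written multiplicatively. -/
abbrev C (n : ℕ) : Type := Multiplicative (ZMod n)

end GroupSequence

namespace GroupSequence

/-! Write `d` and `D` for the two Davenport constants. Appending the inverse of its product to a
product-one free sequence gives an atom, so `D ≥ d + 1`, with equality for abelian groups. Hence `D
= 6` forces `d ≤ 5`, and the first task is to bound the order of a group with `d ≤ 5`.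

Free sequences grow in two ways: a sequence over a normal subgroup combines with lifts of a sequence
over the quotient (`HasFree.of_quotient`), and one term outside a proper subgroup can always be
added (`HasFree.succ_of_ne_top`). With Sylow theory and Burnside transfer this leaves few orders,
all at most 24, and groups of order 32 and exponent 2 (`card_of_not_hasFree_six`). The claim on `|G|
≥ 32` follows at once.

For non-abelian `G`, the remaining orders other than 6 and 8 yield an atom of length at least 7. It
comes either from an abelian subgroup whose free sequence is too long to lie in the centre
(`hasAtom_of_isMulCommutative`), or from two non-commuting elements of order 3 in one coset of a
normal subgroup (`hasAtom_seven_of_order_three`). So a non-abelian group with `D ≤ 6` is `D_6`,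
`Q_8` or `D_8`; each of these has `D = 6`, hence `D ≤ 5` forces commutativity.

For abelian `G` one needs `d = 5` exactly. Olson's bound (`HasFree.le_sum`) evaluates the `p`-groups
that matter, and elements of order 6 or 10 settle the orders 6, 10 and 18. The upper bounds for `D`
use the group order for `C_6` and `D_6`, Olson's bound for the abelian 2-groups, and an argument
modulo the centre in order 8. -/

variable {G H : Type*} [Group G] [Group H]

/-! ### Product-one free sequences under injective homomorphisms -/

theorem isProductOne_coe {l : List G} (h : l.prod = 1) : IsProductOne (l : Multiset G) :=
  ⟨l, rfl, h⟩

theorem isProductOneFree_iff {S : Multiset G} :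
    IsProductOneFree S ↔ ∀ l : List G, (l : Multiset G) ≤ S → l.prod = 1 → l = [] := by
  constructor
  · intro h l hl h1
    by_contra hne
    exact h ⟨l, hl, by
      rw [Multiset.coe_card]; exact List.length_pos_of_ne_nil hne, l, rfl, h1⟩
  · rintro h ⟨T, hT, hc, l, rfl, hl⟩
    rw [h l hT hl] at hc
    simp at hc

theorem IsProductOneFree.mono {S T : Multiset G} (hS : IsProductOneFree S) (h : T ≤ S) :
    IsProductOneFree T := by
  rw [isProductOneFree_iff] at *
  exact fun l hl => hS l (hl.trans h)

theorem exists_list_map_eq {α β : Type*} {f : α → β} {S : Multiset α} {l : List β}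
    (h : (l : Multiset β) ≤ S.map f) : ∃ l' : List α, (l' : Multiset α) ≤ S ∧ l = l'.map f := by
  induction l generalizing S with
  | nil => exact ⟨[], by simp, rfl⟩
  | cons b l ih =>
    obtain ⟨a, ha, rfl⟩ := Multiset.mem_map.1 (Multiset.mem_of_le h (by simp : b ∈ _))
    obtain ⟨S, rfl⟩ := Multiset.exists_cons_of_mem ha
    rw [Multiset.map_cons, ← Multiset.cons_coe, Multiset.cons_le_cons_iff] at h
    obtain ⟨l', hl', rfl⟩ := ih h
    exact ⟨a :: l', by rwa [← Multiset.cons_coe, Multiset.cons_le_cons_iff], rfl⟩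

theorem isProductOne_map_iff (f : G →* H) (hf : Function.Injective f) {S : Multiset G} :
    IsProductOne (S.map f) ↔ IsProductOne S := by
  constructor
  · rintro ⟨l, hl, h1⟩
    obtain ⟨l', hl', rfl⟩ := exists_list_map_eq hl.le
    rw [← Multiset.map_coe] at hl
    refine ⟨l', Multiset.map_injective hf hl, hf ?_⟩
    rw [map_list_prod, h1, map_one]
  · rintro ⟨l, rfl, h1⟩
    exact ⟨l.map f, rfl, by rw [← map_list_prod, h1, map_one]⟩

theorem isProductOneFree_map (f : G →* H) (hf : Function.Injective f) {S : Multiset G}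
    (hS : IsProductOneFree S) : IsProductOneFree (S.map f) := by
  rw [isProductOneFree_iff] at *
  intro l hl h1
  obtain ⟨l', hl', rfl⟩ := exists_list_map_eq hl
  rw [hS l' hl' (hf (by rw [map_list_prod, h1, map_one])), List.map_nil]

/-! ### Attainable lengths in place of the Davenport constants -/

/-- There is a product-one free sequence of length `k`. -/
def HasFree (G : Type*) [Group G] (k : ℕ) : Prop :=
  ∃ S : Multiset G, IsProductOneFree S ∧ Multiset.card S = k

/-- Minimal product-one sequences, i.e. the atoms of `𝓑(G)`. -/
def IsMinimal (S : Multiset G) : Prop :=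
  S ≠ 0 ∧ IsProductOne S ∧
    ∀ T U, T + U = S → IsProductOne T → IsProductOne U → T = 0 ∨ U = 0

/-- There is a minimal product-one sequence of length at least `k`. -/
def HasAtom (G : Type*) [Group G] (k : ℕ) : Prop :=
  ∃ S : Multiset G, IsMinimal S ∧ k ≤ Multiset.card S

theorem addIrreducible_iff (S : productOneMonoid G) :
    AddIrreducible S ↔ IsMinimal (S : Multiset G) := by
  have hu : ∀ T : productOneMonoid G, IsAddUnit T ↔ (T : Multiset G) = 0 := by
    intro T
    constructor
    · intro h
      obtain ⟨U, hU⟩ := h.exists_neg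
      have : (T : Multiset G) + U = 0 := congrArg Subtype.val hU
      exact (add_eq_zero.1 this).1
    · intro h
      have : T = 0 := Subtype.ext h
      rw [this]
      exact isAddUnit_zero
  constructor
  · intro h
    refine ⟨fun h0 => h.not_isAddUnit ((hu S).2 h0), S.2, fun T U hTU hT hU => ?_⟩
    have := h.isAddUnit_or_isAddUnit (a := ⟨T, hT⟩) (b := ⟨U, hU⟩) (Subtype.ext hTU.symm)
    simpa [hu] using this
  · rintro ⟨h0, -, h⟩
    refine ⟨fun hS => h0 ((hu S).1 hS), fun T U hTU => ?_⟩
    rw [hu, hu]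
    exact h T U (by rw [hTU]; rfl) T.2 U.2

/-- Truncation preserves freeness, whereas truncating an atom need not leave an atom. This is why
`HasFree` fixes the length exactly and `HasAtom` only bounds it from below. -/
theorem HasFree.mono {j k : ℕ} (h : HasFree G k) (hj : j ≤ k) : HasFree G j := by
  obtain ⟨S, hS, rfl⟩ := h
  induction S using Quotient.inductionOn with
  | h l =>
    exact ⟨(l.take j : List G), hS.mono (List.take_sublist j l).subperm, by simpa using hj⟩

theorem le_biSup_natCast_iff {α : Type*} (p : α → Prop) (f : α → ℕ) {k : ℕ} (hk : 1 ≤ k) :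
    (k : ℕ∞) ≤ ⨆ x ∈ {x | p x}, (f x : ℕ∞) ↔ ∃ x, p x ∧ k ≤ f x := by
  constructor
  · intro h
    have h1 : ((k - 1 : ℕ) : ℕ∞) < ⨆ x ∈ {x | p x}, (f x : ℕ∞) :=
      lt_of_lt_of_le (by exact_mod_cast Nat.sub_lt hk one_pos) h
    obtain ⟨x, hx⟩ := lt_iSup_iff.1 h1
    obtain ⟨hp, hx⟩ := lt_iSup_iff.1 hx
    have : k - 1 < f x := by exact_mod_cast hx
    exact ⟨x, hp, by omega⟩
  · rintro ⟨x, hp, hx⟩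
    exact le_iSup₂_of_le x hp (by exact_mod_cast hx)

theorem le_smallDavenport_iff {k : ℕ} (hk : 1 ≤ k) :
    (k : ℕ∞) ≤ smallDavenport G ↔ HasFree G k := by
  rw [smallDavenport, le_biSup_natCast_iff _ _ hk]
  constructor
  · rintro ⟨S, hS, h⟩
    exact HasFree.mono ⟨S, hS, rfl⟩ h
  · rintro ⟨S, hS, h⟩
    exact ⟨S, hS, h.ge⟩

theorem le_largeDavenport_iff {k : ℕ} (hk : 1 ≤ k) :
    (k : ℕ∞) ≤ largeDavenport G ↔ HasAtom G k := by
  rw [largeDavenport, le_biSup_natCast_iff AddIrreducible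
    (fun S : productOneMonoid G => Multiset.card (S : Multiset G)) hk]
  constructor
  · rintro ⟨S, hS, h⟩
    exact ⟨S, (addIrreducible_iff S).1 hS, h⟩
  · rintro ⟨S, hS, h⟩
    exact ⟨⟨S, hS.2.1⟩, (addIrreducible_iff _).2 hS, h⟩

theorem eq_natCast_iff {x : ℕ∞} (k : ℕ) : x = k ↔ (k : ℕ∞) ≤ x ∧ ¬ ((k + 1 : ℕ) : ℕ∞) ≤ x := by
  have : ¬ ((k + 1 : ℕ) : ℕ∞) ≤ x ↔ x ≤ k := by
    rw [not_le, Nat.cast_add, Nat.cast_one, ENat.lt_add_one_iff (ENat.natCast_ne_top k)]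
  rw [this, and_comm, le_antisymm_iff]

theorem largeDavenport_eq_iff {k : ℕ} (hk : 1 ≤ k) :
    largeDavenport G = k ↔ HasAtom G k ∧ ¬ HasAtom G (k + 1) := by
  rw [eq_natCast_iff, le_largeDavenport_iff hk, le_largeDavenport_iff (by omega)]

theorem smallDavenport_eq_iff {k : ℕ} (hk : 1 ≤ k) :
    smallDavenport G = k ↔ HasFree G k ∧ ¬ HasFree G (k + 1) := by
  rw [eq_natCast_iff, le_smallDavenport_iff hk, le_smallDavenport_iff (by omega)]

/-! ### Building free sequences from subgroups and quotients -/

theorem HasFree.map {k : ℕ} (h : HasFree G k) (f : G →* H) (hf : Function.Injective f) :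
    HasFree H k := by
  obtain ⟨S, hS, rfl⟩ := h
  exact ⟨S.map f, isProductOneFree_map f hf hS, Multiset.card_map _ _⟩

theorem exists_multiset_map_eq {α β : Type*} {f : α → β} {S : Multiset α} {T : Multiset β}
    (h : T ≤ S.map f) : ∃ T' ≤ S, T = T'.map f := by
  induction T using Quotient.inductionOn with
  | h l =>
    obtain ⟨l', h1, rfl⟩ := exists_list_map_eq h
    exact ⟨l', h1, rfl⟩

theorem IsMinimal.map {S : Multiset G} (h : IsMinimal S) (f : G →* H)
    (hf : Function.Injective f) : IsMinimal (S.map f) := by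
  obtain ⟨h0, h1, h2⟩ := h
  refine ⟨by simpa using h0, (isProductOne_map_iff f hf).2 h1, fun T U hTU hT hU => ?_⟩
  obtain ⟨T, -, rfl⟩ := exists_multiset_map_eq (S := S) (hTU ▸ Multiset.le_add_right T U)
  obtain ⟨U, -, rfl⟩ := exists_multiset_map_eq (S := S) (hTU ▸ Multiset.le_add_left U _)
  rw [isProductOne_map_iff f hf] at hT hU
  rw [← Multiset.map_add] at hTU
  simpa using h2 T U (Multiset.map_injective hf hTU) hT hU

theorem HasAtom.map {k : ℕ} (h : HasAtom G k) (f : G →* H) (hf : Function.Injective f) :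
    HasAtom H k := by
  obtain ⟨S, hS, hk⟩ := h
  exact ⟨S.map f, hS.map f hf, by rwa [Multiset.card_map]⟩

theorem HasFree.of_subgroup {K : Subgroup G} {k : ℕ} (h : HasFree K k) : HasFree G k :=
  h.map K.subtype K.subtype_injective

/-- Sequences over the kernel of a homomorphism combine with lifts of sequences over the
codomain. -/
theorem isProductOneFree_add (f : G →* H) {S T : Multiset G} (hS : IsProductOneFree S)
    (hker : ∀ x ∈ S, f x = 1) (hT : IsProductOneFree (T.map f)) : IsProductOneFree (S + T) := by
  classical
  rw [isProductOneFree_iff] at *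
  have hT1 : ∀ x ∈ T, f x ≠ 1 := fun x hx h1 => by
    have := hT [f x] (by simpa using ⟨x, hx, rfl⟩) (by simpa using h1)
    simp at this
  have hSf : S.filter (fun x => f x ≠ 1) = 0 :=
    Multiset.filter_eq_nil.2 fun x hx => by simp [hker x hx]
  have hTf : T.filter (fun x => f x ≠ 1) = T := Multiset.filter_eq_self.2 hT1
  intro l hl h1
  -- Terms in the kernel do not affect the image of a product, so the images of the other terms of
  -- `l` already multiply to 1. Freeness of `T.map f` leaves no such terms, and `l` lies inside `S`.
  have hfil : ∀ m : List G, ((m.filter (fun x => f x ≠ 1)).map f).prod = (m.map f).prod := by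
    intro m
    induction m with
    | nil => rfl
    | cons a m ih =>
      by_cases ha : f a = 1 <;> simp_all
  have h2 := hT ((l.filter (fun x => f x ≠ 1)).map f) (by
    rw [← Multiset.map_coe]
    apply Multiset.map_le_map
    have := Multiset.filter_le_filter (fun x => f x ≠ 1) hl
    rwa [Multiset.filter_add, hSf, hTf, zero_add, Multiset.filter_coe] at this)
    (by rw [hfil, ← map_list_prod, h1, map_one])
  have h3 : ∀ x ∈ l, f x = 1 := by simpa using h2
  have h4 : (l : Multiset G) ≤ S := by
    have := Multiset.filter_le_filter (fun x => f x = 1) hl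
    rw [Multiset.filter_add, Multiset.filter_eq_self.2 hker,
      (Multiset.filter_eq_nil (p := fun x => f x = 1)).2 hT1, add_zero,
      Multiset.filter_eq_self.2 (by simpa using h3)] at this
    exact this
  exact hS l h4 h1

theorem HasFree.of_quotient {N : Subgroup G} [N.Normal] {j k : ℕ} (hN : HasFree N j)
    (hQ : HasFree (G ⧸ N) k) : HasFree G (j + k) := by
  obtain ⟨S, hS, rfl⟩ := hN
  obtain ⟨T, hT, rfl⟩ := hQ
  refine ⟨S.map N.subtype + T.map Quotient.out, isProductOneFree_add (QuotientGroup.mk' N)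
    (isProductOneFree_map _ N.subtype_injective hS) ?_ ?_, by simp⟩
  · simp only [Multiset.mem_map, QuotientGroup.mk'_apply, QuotientGroup.eq_one_iff]
    rintro _ ⟨x, -, rfl⟩
    exact x.2
  · rw [Multiset.map_map]
    convert hT
    conv_rhs => rw [← Multiset.map_id T]
    exact Multiset.map_congr rfl fun x _ => by simp

/-- A list product which contains precisely one factor outside of `K` is outside of `K`. -/
theorem prod_notMem_of_unique {K : Subgroup G} {l₁ l₂ : List G} {x : G} (h₁ : ∀ y ∈ l₁, y ∈ K)
    (h₂ : ∀ y ∈ l₂, y ∈ K) (hx : x ∉ K) : (l₁ ++ x :: l₂).prod ∉ K := by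
  rw [List.prod_append, List.prod_cons, K.mul_mem_cancel_left (K.list_prod_mem h₁),
    K.mul_mem_cancel_right (K.list_prod_mem h₂)]
  exact hx

theorem not_isProductOne_add_singleton {K : Subgroup G} {S : Multiset G} {x : G}
    (hS : ∀ y ∈ S, y ∈ K) (hx : x ∉ K) : ¬ IsProductOne (S + {x}) := by
  rintro ⟨l, hl, h1⟩
  have hxl : x ∈ l := by rw [← Multiset.mem_coe, hl]; simp
  obtain ⟨l₁, l₂, rfl⟩ := List.append_of_mem hxl
  have : (↑(l₁ ++ l₂) : Multiset G) = S := by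
    rw [← Multiset.coe_eq_coe.2 List.perm_middle.symm] at hl
    rw [← Multiset.cons_coe, ← Multiset.singleton_add, add_comm] at hl
    exact add_right_cancel hl
  subst this
  refine prod_notMem_of_unique (K := K) (l₁ := l₁) (l₂ := l₂) ?_ ?_ hx (by rw [h1]; exact K.one_mem)
  · exact fun y hy => hS y (by simp [hy])
  · exact fun y hy => hS y (by simp [hy])

theorem IsProductOneFree.add_singleton {K : Subgroup G} {S : Multiset G} {x : G}
    (h : IsProductOneFree S) (hS : ∀ y ∈ S, y ∈ K) (hx : x ∉ K) :
    IsProductOneFree (S + {x}) := by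
  classical
  rw [isProductOneFree_iff] at *
  intro l hl h1
  by_cases hxl : x ∈ l
  · exfalso
    have hxl' : ({x} : Multiset G) ≤ l := by simpa using hxl
    have : (l : Multiset G) - {x} + {x} = l := tsub_add_cancel_of_le hxl'
    refine not_isProductOne_add_singleton (S := (l : Multiset G) - {x}) (K := K) ?_ hx
      (by rw [this]; exact isProductOne_coe h1)
    intro y hy
    exact hS y (Multiset.mem_of_le (tsub_le_iff_right.2 hl) hy)
  · refine h l ?_ h1
    rw [add_comm, Multiset.singleton_add] at hl
    exact (Multiset.le_cons_of_notMem (by simpa using hxl)).1 hl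

theorem HasFree.succ_of_ne_top {K : Subgroup G} {k : ℕ} (h : HasFree K k) (hK : K ≠ ⊤) :
    HasFree G (k + 1) := by
  obtain ⟨S, hS, rfl⟩ := h
  obtain ⟨x, hx⟩ : ∃ x, x ∉ K := by
    by_contra! hc
    exact hK ((Subgroup.eq_top_iff' K).2 hc)
  refine ⟨S.map K.subtype + {x}, (isProductOneFree_map _ K.subtype_injective hS).add_singleton
    (K := K) ?_ hx, by simp⟩
  simp only [Multiset.mem_map]
  rintro _ ⟨y, -, rfl⟩
  exact y.2

theorem isProductOneFree_replicate {g : G} {n : ℕ} (h : n < orderOf g ∨ orderOf g = 0) :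
    IsProductOneFree (Multiset.replicate n g) := by
  rw [isProductOneFree_iff]
  intro l hl h1
  have hl' : l = List.replicate l.length g :=
    List.eq_replicate_of_mem fun b hb => Multiset.eq_of_mem_replicate (Multiset.mem_of_le hl hb)
  have hlen : l.length ≤ n := by simpa using Multiset.card_le_card hl
  rw [hl', List.prod_replicate] at h1
  rw [← List.length_eq_zero_iff]
  by_contra h0
  have hd := orderOf_dvd_of_pow_eq_one h1
  rcases h with h | h
  · exact absurd (Nat.le_of_dvd (Nat.pos_of_ne_zero h0) hd) (by omega)
  · rw [h, zero_dvd_iff] at hd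
    exact h0 hd

theorem hasFree_of_lt_orderOf {g : G} {k : ℕ} (h : k < orderOf g) : HasFree G k :=
  ⟨_, isProductOneFree_replicate (Or.inl h), Multiset.card_replicate _ _⟩

theorem hasFree_succ_of_lt_orderOf {g : G} {k : ℕ} (h : k < orderOf g)
    (hg : Subgroup.zpowers g ≠ ⊤) : HasFree G (k + 1) :=
  HasFree.succ_of_ne_top (K := Subgroup.zpowers g)
    (hasFree_of_lt_orderOf (g := ⟨g, Subgroup.mem_zpowers g⟩) (by simpa using h)) hg

theorem hasFree_zero : HasFree G 0 := ⟨0, isProductOneFree_iff.2 (by simp), rfl⟩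

theorem hasFree_one [Nontrivial G] : HasFree G 1 := by
  obtain ⟨x, hx⟩ := exists_ne (1 : G)
  refine ⟨{x}, ?_, rfl⟩
  have := (isProductOneFree_iff.2 (by simp) : IsProductOneFree (0 : Multiset G)).add_singleton
    (K := ⊥) (x := x) (by simp) (by simpa using hx)
  simpa using this

/-! ### Free sequences versus atoms -/

theorem IsProductOneFree.eq_zero {S T : Multiset G} (hS : IsProductOneFree S) (hT : T ≤ S)
    (h : IsProductOne T) : T = 0 := by
  obtain ⟨l, rfl, h1⟩ := h
  rw [isProductOneFree_iff.1 hS l hT h1, Multiset.coe_nil]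

theorem split_add_singleton {α : Type*} {S T U : Multiset α} {y : α} (h : T + U = S + {y}) :
    (∃ T', T = T' + {y} ∧ T' + U = S) ∨ (∃ U', U = U' + {y} ∧ T + U' = S) := by
  classical
  have hy : y ∈ T + U := by rw [h]; simp
  rcases Multiset.mem_add.1 hy with hy | hy
  · obtain ⟨T', rfl⟩ := Multiset.exists_cons_of_mem hy
    refine Or.inl ⟨T', by rw [add_comm, Multiset.singleton_add], ?_⟩
    rw [← Multiset.singleton_add, add_assoc, add_comm] at h
    exact add_right_cancel h
  · obtain ⟨U', rfl⟩ := Multiset.exists_cons_of_mem hy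
    refine Or.inr ⟨U', by rw [add_comm, Multiset.singleton_add], ?_⟩
    rw [← Multiset.singleton_add, add_comm ({y} : Multiset α), ← add_assoc] at h
    exact add_right_cancel h

/-- In any factorization one of the two parts avoids the added term, so it is a product-one
subsequence of a free sequence and therefore empty. -/
theorem IsProductOneFree.isMinimal {l : List G} (hl : IsProductOneFree (l : Multiset G)) :
    IsMinimal ((l : Multiset G) + {l.prod⁻¹}) := by
  refine ⟨by simp, isProductOne_coe (l := l ++ [l.prod⁻¹]) (by simp), fun T U h hT hU => ?_⟩
  rcases split_add_singleton h with ⟨T', -, h'⟩ | ⟨U', -, h'⟩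
  · exact Or.inr (hl.eq_zero (h' ▸ Multiset.le_add_left _ _) hU)
  · exact Or.inl (hl.eq_zero (h' ▸ Multiset.le_add_right _ _) hT)

theorem HasFree.hasAtom {k : ℕ} (h : HasFree G k) : HasAtom G (k + 1) := by
  obtain ⟨S, hS, rfl⟩ := h
  induction S using Quotient.inductionOn with
  | h l => exact ⟨_, hS.isMinimal, by simp⟩

/-- Order an atom so that its product is 1. If it had more than `|G|` terms, two of its proper
prefixes would have equal products; the segment between them and its complement would then be
nonempty product-one sequences. -/
theorem HasAtom.le_card [Finite G] {k : ℕ} (h : HasAtom G k) : k ≤ Nat.card G := by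
  obtain ⟨_, ⟨-, ⟨l, rfl, h1⟩, h2⟩, hk⟩ := h
  refine hk.trans ?_
  rw [Multiset.coe_card]
  by_contra! hlt
  have : ¬ Function.Injective (fun i : Fin l.length => (l.take i).prod) := fun hinj => by
    have := Nat.card_le_card_of_injective _ hinj
    rw [Nat.card_fin] at this
    omega
  rw [Function.not_injective_iff] at this
  obtain ⟨i, j, hij, hne⟩ := this
  wlog hlt' : i < j generalizing i j
  · exact this j i hij.symm hne.symm (lt_of_le_of_ne (not_lt.1 hlt') hne.symm)
  have hi := i.2
  have hj := j.2
  have hlt'' : (i : ℕ) < j := hlt'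
  have htake : (l.take j).take i = l.take i := by
    rw [List.take_take, min_eq_left hlt''.le]
  have hm : ((l.take j).drop i).prod = 1 := by
    have := List.prod_take_mul_prod_drop (l.take j) i
    rw [htake] at this
    rw [hij] at this
    simpa using this
  have hr : (l.take i ++ l.drop j).prod = 1 := by
    rw [List.prod_append]
    rw [hij, List.prod_take_mul_prod_drop, h1]
  have hsum : (((l.take j).drop i : List G) : Multiset G) + (l.take i ++ l.drop j : List G) = l := by
    rw [Multiset.coe_add, Multiset.coe_eq_coe]
    have e : l = l.take i ++ ((l.take j).drop i ++ l.drop j) := by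
      conv_lhs => rw [← List.take_append_drop j l, ← List.take_append_drop i (l.take j), htake,
        List.append_assoc]
    conv_rhs => rw [e]
    rw [← List.append_assoc, ← List.append_assoc]
    exact List.perm_append_comm.append_right _
  have hlen := congrArg Multiset.card hsum
  rcases h2 _ _ hsum (isProductOne_coe hm) (isProductOne_coe hr) with h | h
  · have := congrArg Multiset.card h
    simp at this
    omega
  · have := congrArg Multiset.card h
    simp at this
    omega

theorem prod_eq_of_perm {l l' : List G} (h : l.Perm l') (hc : ∀ a ∈ l, ∀ b ∈ l, Commute a b) :
    l.prod = l'.prod := by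
  refine h.prod_eq' ?_
  rw [List.pairwise_iff_forall_sublist]
  intro a b hab
  have := hab.subset
  exact hc a (this (by simp)) b (this (by simp))

/-- This cancellation fails for non-commuting terms, which is what lets `D` exceed `d + 1` in
non-abelian groups. -/
theorem IsProductOne.of_add_of_commute {S T : Multiset G} (hST : IsProductOne (S + T))
    (hT : IsProductOne T) (hc : ∀ a ∈ S + T, ∀ b ∈ S + T, Commute a b) : IsProductOne S := by
  obtain ⟨l, hl, h1⟩ := hST
  obtain ⟨m, rfl, hm⟩ := hT
  induction S using Quotient.inductionOn with
  | h s =>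
    refine isProductOne_coe (l := s) ?_
    have hp : (s ++ m).Perm l := Multiset.coe_eq_coe.1 (by rw [hl, ← Multiset.coe_add]; rfl)
    have := prod_eq_of_perm hp (fun a ha b hb => hc a (by simpa using ha) b (by simpa using hb))
    rwa [List.prod_append, hm, mul_one, h1] at this

theorem IsMinimal.isProductOneFree_of_cons {A : Multiset G} {u : G} (h : IsMinimal (u ::ₘ A))
    (hc : ∀ a ∈ u ::ₘ A, ∀ b ∈ u ::ₘ A, Commute a b) : IsProductOneFree A := by
  rw [isProductOneFree_iff]
  intro l hl hl1
  obtain ⟨R, rfl⟩ := Multiset.le_iff_exists_add.1 hl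
  have e : (u ::ₘ R) + (l : Multiset G) = u ::ₘ (l + R) := by
    rw [Multiset.cons_add, add_comm R]
  have hl' := isProductOne_coe hl1
  rcases h.2.2 _ _ e ((e.symm ▸ h.2.1).of_add_of_commute hl' (e.symm ▸ hc)) hl' with h | h
  · simp at h
  · simpa using h

theorem HasAtom.hasFree {k : ℕ} (h : HasAtom G (k + 1)) (hc : ∀ a b : G, a * b = b * a) :
    HasFree G k := by
  obtain ⟨S, hS, hk⟩ := h
  obtain ⟨u, hu⟩ := Multiset.exists_mem_of_ne_zero hS.1
  obtain ⟨A, rfl⟩ := Multiset.exists_cons_of_mem hu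
  exact HasFree.mono ⟨A, hS.isProductOneFree_of_cons fun a _ b _ => hc a b, rfl⟩
    (by simpa using hk)

/-- A relation `a ^ i * b * a ^ j = 1` can be rotated, so all orderings of such a sequence reduce to
a single equation. -/
theorem mul_pow_eq_one_of_isProductOne {a b : G} {n : ℕ}
    (h : IsProductOne (Multiset.replicate n a + {b})) : b * a ^ n = 1 := by
  obtain ⟨l, hl, h1⟩ := h
  have hb : b ∈ l := by rw [← Multiset.mem_coe, hl]; simp
  obtain ⟨l₁, l₂, rfl⟩ := List.append_of_mem hb
  have hp : (↑(l₁ ++ l₂) : Multiset G) = Multiset.replicate n a := by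
    rw [← Multiset.coe_eq_coe.2 List.perm_middle.symm] at hl
    rw [← Multiset.cons_coe, ← Multiset.singleton_add, add_comm] at hl
    exact add_right_cancel hl
  have hmem : ∀ y ∈ l₁ ++ l₂, y = a := fun y hy =>
    Multiset.eq_of_mem_replicate (n := n) (by rw [← hp]; exact Multiset.mem_coe.2 hy)
  have hlen : l₁.length + l₂.length = n := by
    simpa using congrArg Multiset.card hp
  have e₁ : l₁ = List.replicate l₁.length a :=
    List.eq_replicate_of_mem fun y hy => hmem y (by simp [hy])
  have e₂ : l₂ = List.replicate l₂.length a :=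
    List.eq_replicate_of_mem fun y hy => hmem y (by simp [hy])
  rw [List.prod_append, List.prod_cons, e₁, e₂, List.prod_replicate, List.prod_replicate] at h1
  have h2 := mul_eq_one_iff_inv_eq.1 h1
  rw [← hlen, add_comm, pow_add, ← mul_assoc, ← h2, inv_mul_cancel]

/-! ### Long atoms in non-abelian groups -/

/-- A sequence of commuting terms, one of which does not commute with `x`, yields an atom
involving a conjugate of `x⁻¹`. -/
theorem isMinimal_of_not_commute {l : List G} {t x : G}
    (hl : IsProductOneFree ((t :: l : List G) : Multiset G))
    (hc : ∀ a ∈ t :: l, ∀ b ∈ t :: l, Commute a b) (hx : ¬ Commute x t) :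
    IsMinimal (((t :: l : List G) : Multiset G) + {(t :: l).prod⁻¹} + {x} + {t * x⁻¹ * t⁻¹}) := by
  set A : Multiset G := ((t :: l : List G) : Multiset G) + {(t :: l).prod⁻¹} with hA
  have hmin : IsMinimal A := hl.isMinimal
  set K : Subgroup G := Subgroup.closure {a | a ∈ t :: l}
  have hK : IsMulCommutative K := Subgroup.isMulCommutative_closure fun a ha b hb => hc a ha b hb
  have hKc : ∀ a ∈ K, ∀ b ∈ K, Commute a b := fun a ha b hb =>
    congrArg Subtype.val (hK.is_comm.comm ⟨a, ha⟩ ⟨b, hb⟩)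
  have hlK : ∀ a ∈ t :: l, a ∈ K := fun a ha => Subgroup.subset_closure ha
  have htK : t ∈ K := hlK t (by simp)
  have hAK : ∀ a ∈ A, a ∈ K := by
    intro a ha
    rw [hA, Multiset.mem_add, Multiset.mem_singleton] at ha
    rcases ha with ha | rfl
    · exact hlK a ha
    · exact K.inv_mem (K.list_prod_mem hlK)
  have hxK : x ∉ K := fun h => hx (hKc x h t htK)
  have hyK : t * x⁻¹ * t⁻¹ ∉ K := by
    rw [K.mul_mem_cancel_right (K.inv_mem htK), K.mul_mem_cancel_left htK, K.inv_mem_iff]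
    exact hxK
  -- In a factorization, `x` must accompany its inverse conjugate, since a product with a single
  -- factor outside `K` is not 1. The other part `U` then lies in `A`. By commutativity and
  -- minimality of `A`, either `U` is empty or `x` and `t * x⁻¹ * t⁻¹` alone have product one, which
  -- would make `x` commute with `t`.
  have key : ∀ T U, T + U = A + {x} → IsProductOne (T + {t * x⁻¹ * t⁻¹}) → IsProductOne U →
      U = 0 := by
    intro T U h hT hU
    rcases split_add_singleton h with ⟨T', rfl, h'⟩ | ⟨U', rfl, h'⟩
    · have hT' : IsProductOne T' := by
        refine IsProductOne.of_add_of_commute (T := U) (h' ▸ hmin.2.1) hU ?_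
        rw [h']
        exact fun a ha b hb => hKc a (hAK a ha) b (hAK b hb)
      refine (hmin.2.2 T' U h' hT' hU).resolve_left ?_
      rintro rfl
      have hxy : t * x⁻¹ * t⁻¹ * x = 1 := by
        simpa using mul_pow_eq_one_of_isProductOne (a := x) (n := 1) (by simpa using hT)
      apply hx
      rw [mul_eq_one_iff_inv_eq] at hxy
      rw [commute_iff_eq]
      conv_lhs => rw [← hxy]
      group
    · refine absurd hT (not_isProductOne_add_singleton (K := K) (fun a ha => hAK a ?_) hyK)
      rw [← h']
      exact Multiset.mem_add.2 (Or.inl ha)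
  refine ⟨by simp, ?_, fun T U h hT hU => ?_⟩
  · have hword : ([t, x] ++ (l ++ [(t :: l).prod⁻¹] ++ [t * x⁻¹ * t⁻¹])).prod = 1 := by
      simp [mul_assoc]
    convert isProductOne_coe hword using 1
    rw [hA]
    simp only [← Multiset.coe_singleton, Multiset.coe_add, Multiset.coe_eq_coe]
    simp only [List.cons_append, List.nil_append, List.append_assoc, List.perm_cons]
    exact (List.perm_append_comm (l₁ := l ++ [(t :: l).prod⁻¹]) (l₂ := [x])).append_right
      [t * x⁻¹ * t⁻¹] |>.trans (by simp) |> (by simpa using ·)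
  · rcases split_add_singleton h with ⟨T', rfl, h'⟩ | ⟨U', rfl, h'⟩
    · exact Or.inr (key T' U h' hT hU)
    · exact Or.inl (key U' T (by rw [add_comm, h']) hU hT)

theorem IsProductOneFree.of_map (f : G →* H) {S : Multiset G}
    (hS : IsProductOneFree (S.map f)) : IsProductOneFree S := by
  rw [isProductOneFree_iff] at *
  intro l hl h1
  simpa using hS (l.map f) (by rw [← Multiset.map_coe]; exact Multiset.map_le_map hl)
    (by rw [← map_list_prod, h1, map_one])

/-- A free sequence of length `k` over the centre would give an atom of length `k + 1` there,
exceeding the order of the centre. So some term `t` is non-central, and any `x` not commuting with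
`t` gives an atom with three extra terms. -/
theorem hasAtom_of_isMulCommutative [Finite G] {K : Subgroup G} [hK : IsMulCommutative K] {k : ℕ}
    (h : HasFree K k) (hZ : Nat.card (Subgroup.center G) ≤ k) : HasAtom G (k + 3) := by
  obtain ⟨S, hS, rfl⟩ := h
  have hfree := isProductOneFree_map K.subtype K.subtype_injective hS
  obtain ⟨t, ht, htZ⟩ : ∃ t ∈ S.map K.subtype, t ∉ Subgroup.center G := by
    by_contra! hall
    obtain ⟨S', hS'⟩ : ∃ S' : Multiset (Subgroup.center G),
        S'.map (Subgroup.center G).subtype = S.map K.subtype := by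
      lift S.map K.subtype to Multiset (Subgroup.center G) using hall with S'
      exact ⟨S', rfl⟩
    have h1 : HasFree (Subgroup.center G) (Multiset.card S) :=
      ⟨S', IsProductOneFree.of_map (Subgroup.center G).subtype (hS' ▸ hfree), by
        rw [← Multiset.card_map (Subgroup.center G).subtype, hS', Multiset.card_map]⟩
    have := h1.hasAtom.le_card
    omega
  obtain ⟨x, hx⟩ : ∃ x, ¬ Commute x t := by
    by_contra! hall
    exact htZ (Subgroup.mem_center_iff.2 hall)
  obtain ⟨R, hR⟩ := Multiset.exists_cons_of_mem ht
  have hcard := congrArg Multiset.card hR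
  induction R using Quotient.inductionOn with
  | h l =>
    have e : t ::ₘ (Quotient.mk _ l : Multiset G) = ((t :: l : List G) : Multiset G) := rfl
    rw [hR, e] at hfree
    refine ⟨_, isMinimal_of_not_commute hfree ?_ hx, ?_⟩
    · have hmem : ∀ a ∈ t :: l, a ∈ K := by
        intro a ha
        rw [← Multiset.mem_coe, ← e, ← hR, Multiset.mem_map] at ha
        obtain ⟨y, -, rfl⟩ := ha
        exact y.2
      exact fun a ha b hb => congrArg Subtype.val
        (hK.is_comm.comm ⟨a, hmem a ha⟩ ⟨b, hmem b hb⟩)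
    · simp at hcard ⊢
      omega

theorem exists_replicate_of_add_eq {α : Type*} {T U : Multiset α} {a b : α} {m n : ℕ}
    (h : T + U = Multiset.replicate m a + Multiset.replicate n b) :
    ∃ i ≤ m, ∃ j ≤ n, U = Multiset.replicate i a + Multiset.replicate j b ∧
      T = Multiset.replicate (m - i) a + Multiset.replicate (n - j) b := by
  induction m generalizing T U with
  | zero =>
    rw [Multiset.replicate_zero, zero_add] at h
    have hT := Multiset.eq_replicate.1 h
    refine ⟨0, le_rfl, Multiset.card U, ?_, ?_, ?_⟩
    · rw [← hT.1, Multiset.card_add]; omega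
    · rw [Multiset.replicate_zero, zero_add]
      exact Multiset.eq_replicate_card.2 fun y hy => hT.2 y (Multiset.mem_add.2 (Or.inr hy))
    · have : n - Multiset.card U = Multiset.card T := by
        rw [← hT.1, Multiset.card_add]; omega
      rw [this, Nat.zero_sub, Multiset.replicate_zero, zero_add]
      exact Multiset.eq_replicate_card.2 fun y hy => hT.2 y (Multiset.mem_add.2 (Or.inl hy))
  | succ m ih =>
    have e : ∀ k, Multiset.replicate (k + 1) a + Multiset.replicate n b =
        Multiset.replicate k a + Multiset.replicate n b + {a} := fun k => by
      rw [Multiset.replicate_succ, ← Multiset.singleton_add]; abel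
    rw [e] at h
    rcases split_add_singleton h with ⟨T', rfl, h'⟩ | ⟨U', rfl, h'⟩
    · obtain ⟨i, hi, j, hj, rfl, rfl⟩ := ih h'
      refine ⟨i, by omega, j, hj, rfl, ?_⟩
      rw [Nat.succ_sub hi, Multiset.replicate_succ, ← Multiset.singleton_add]; abel
    · obtain ⟨i, hi, j, hj, rfl, rfl⟩ := ih h'
      refine ⟨i + 1, by omega, j, hj, ?_, by rw [Nat.add_sub_add_right]⟩
      rw [Multiset.replicate_succ, ← Multiset.singleton_add]; abel

/-- The atom consists of three copies each of `g` and `k`, and one further term `v`. Modulo `N` both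
`g` and `k` become the same element of order 3, so a product-one part avoiding `v` has length 0, 3
or 6. Length 3 would force `g = k` or `v = 1`, and length 6 would force `v = 1`. -/
theorem hasAtom_seven_of_order_three {N : Subgroup G} [N.Normal] {g k : G} (hg : g ^ 3 = 1)
    (hk : k ^ 3 = 1) (hgN : g ∉ N) (hgk : g⁻¹ * k ∈ N) (hc : ¬ Commute g k) : HasAtom G 7 := by
  set v := (g * g * k * g * k * k)⁻¹ with hv
  have hne : g ≠ k := by rintro rfl; exact hc (Commute.refl g)
  have hkk : k * k = k⁻¹ := by
    rw [eq_inv_iff_mul_eq_one, ← hk, pow_three']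
  have hgg : g * g = g⁻¹ := by
    rw [eq_inv_iff_mul_eq_one, ← hg, pow_three']
  -- Since `g * g = g⁻¹` and `k * k = k⁻¹`, the word inverted in `v` is the commutator `g⁻¹ * k * g
  -- * k⁻¹`.
  have hv1 : v ≠ 1 := by
    intro h
    rw [hv, inv_eq_one, mul_assoc _ k k, hkk, hgg, mul_inv_eq_one, mul_assoc,
      inv_mul_eq_iff_eq_mul] at h
    exact hc h.symm
  have hkg : (k : G ⧸ N) = g := (QuotientGroup.eq.2 hgk).symm
  have hord : orderOf (g : G ⧸ N) = 3 := by
    have : Fact (Nat.Prime 3) := ⟨Nat.prime_three⟩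
    refine orderOf_eq_prime ?_ ?_
    · rw [← QuotientGroup.mk_pow, hg, QuotientGroup.mk_one]
    · rwa [Ne, QuotientGroup.eq_one_iff]
  have key : ∀ T U, T + U = Multiset.replicate 3 g + Multiset.replicate 3 k →
      IsProductOne (T + {v}) → IsProductOne U → U = 0 := by
    intro T U h hT hU
    obtain ⟨i, hi, j, hj, rfl, rfl⟩ := exists_replicate_of_add_eq h
    have hdvd : 3 ∣ i + j := by
      obtain ⟨l, hl, hl1⟩ := hU
      have hlen : l.length = i + j := by simpa using congrArg Multiset.card hl
      have hmem : ∀ y ∈ l.map (QuotientGroup.mk' N), y = (g : G ⧸ N) := by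
        intro y hy
        obtain ⟨z, hz, rfl⟩ := List.mem_map.1 hy
        rw [← Multiset.mem_coe, hl, Multiset.mem_add] at hz
        rcases hz with hz | hz
        · rw [Multiset.eq_of_mem_replicate hz]; rfl
        · rw [Multiset.eq_of_mem_replicate hz]; exact hkg
      have h1 := congrArg (QuotientGroup.mk' N) hl1
      rw [map_list_prod, List.eq_replicate_of_mem hmem, List.prod_replicate, List.length_map, hlen,
        map_one] at h1
      rw [← hord]
      exact orderOf_dvd_of_pow_eq_one h1
    have hk2 : k * g ^ 2 = 1 → False := fun h => hne (by
      rw [mul_eq_one_iff_eq_inv] at h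
      rw [h, pow_two, hgg, inv_inv])
    have hg2 : g * k ^ 2 = 1 → False := fun h => hne (by
      rw [mul_eq_one_iff_eq_inv] at h
      rw [h, pow_two, hkk, inv_inv])
    interval_cases i <;> interval_cases j <;> try omega
    · rfl
    · have := mul_pow_eq_one_of_isProductOne (a := g) (n := 3) (b := v) (by simpa using hT)
      exact (hv1 (by simpa [hg] using this)).elim
    · exact (hg2 (mul_pow_eq_one_of_isProductOne (a := k) (n := 2) (b := g)
        (by rw [add_comm]; exact hU))).elim
    · exact (hk2 (mul_pow_eq_one_of_isProductOne (a := g) (n := 2) (b := k) hU)).elim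
    · have := mul_pow_eq_one_of_isProductOne (a := k) (n := 3) (b := v) (by simpa using hT)
      exact (hv1 (by simpa [hk] using this)).elim
    · have := mul_pow_eq_one_of_isProductOne (a := k) (n := 0) (b := v) (by simpa using hT)
      exact (hv1 (by simpa using this)).elim
  refine ⟨Multiset.replicate 3 g + Multiset.replicate 3 k + {v}, ⟨by simp, ?_, ?_⟩, by simp⟩
  · have hword : [g, g, k, g, k, k, v].prod = 1 := by
      simp [hv, mul_assoc]
    convert isProductOne_coe hword using 1
    simp only [Multiset.replicate_succ, Multiset.replicate_zero, ← Multiset.cons_coe,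
      Multiset.coe_nil,
      ← Multiset.singleton_add, add_zero]
    abel
  · intro T U h hT hU
    rcases split_add_singleton h with ⟨T', rfl, h'⟩ | ⟨U', rfl, h'⟩
    · exact Or.inr (key T' U h' hT hU)
    · exact Or.inl (key U' T (by rw [add_comm, h']) hU hT)

/-- The atom has two copies of `x` and four of `r`, ordered as `x r r x r r`. The copies of `x`
cannot be separated, because `x * r ^ j ≠ 1`. Splitting off `r ^ 3` leaves two copies of `x` and one
`r`, whose product is `r ≠ 1`. -/
theorem hasAtom_six_of_order_three {r x : G} (hr : r ^ 3 = 1) (hr1 : r ≠ 1) (hx : x ^ 2 = 1)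
    (hxr : x * r * x = r⁻¹) : HasAtom G 6 := by
  have : Fact (Nat.Prime 3) := ⟨Nat.prime_three⟩
  have hord : orderOf r = 3 := orderOf_eq_prime hr hr1
  have hxj : ∀ j : ℕ, x * r ^ j ≠ 1 := by
    intro j h
    have hc : Commute x r := by
      rw [mul_eq_one_iff_eq_inv.1 h]
      exact ((Commute.refl r).pow_left j).inv_left
    rw [hc.eq, mul_assoc, ← pow_two, hx, mul_one, eq_inv_iff_mul_eq_one, ← pow_two] at hxr
    exact absurd (hord ▸ orderOf_dvd_of_pow_eq_one hxr) (by norm_num)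
  have key : ∀ j ≤ 4, IsProductOne (Multiset.replicate 0 x + Multiset.replicate j r) →
      IsProductOne (Multiset.replicate 2 x + Multiset.replicate (4 - j) r) → j = 0 := by
    intro j hj h h'
    have h1 : r ^ j = 1 := by
      obtain ⟨l, hl, hl1⟩ := h
      rw [Multiset.replicate_zero, zero_add, ← Multiset.coe_replicate, Multiset.coe_eq_coe,
        List.perm_replicate] at hl
      rwa [hl, List.prod_replicate] at hl1
    have h3 : 3 ∣ j := hord ▸ orderOf_dvd_of_pow_eq_one h1
    by_contra h0
    obtain rfl : j = 3 := by omega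
    have := mul_pow_eq_one_of_isProductOne (a := x) (n := 2) (b := r) (by simpa using h')
    rw [hx, mul_one] at this
    exact hr1 this
  refine ⟨Multiset.replicate 2 x + Multiset.replicate 4 r, ⟨by simp, ?_, ?_⟩, by simp⟩
  · have hword : [x, r, r, x, r, r].prod = 1 := by
      have : x * r * r * x = r⁻¹ * r⁻¹ := by
        calc x * r * r * x = (x * r * x) * (x⁻¹ * x⁻¹) * (x * r * x) := by group
          _ = _ := by rw [hxr, ← mul_inv_rev, ← pow_two, hx]; group
      have h2 : [x, r, r, x, r, r].prod = x * r * r * x * (r * r) := by simp [mul_assoc]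
      rw [h2, this]; group
    convert isProductOne_coe hword using 1
    simp only [Multiset.replicate_succ, Multiset.replicate_zero, ← Multiset.cons_coe,
      Multiset.coe_nil,
      ← Multiset.singleton_add, add_zero]
    abel
  · intro T U h hT hU
    obtain ⟨i, hi, j, hj, rfl, rfl⟩ := exists_replicate_of_add_eq h
    interval_cases i
    · rw [key j hj hU hT]
      simp
    · exact absurd (mul_pow_eq_one_of_isProductOne (a := r) (n := j) (b := x)
        (by rw [add_comm]; exact hU)) (hxj j)
    · have := key (4 - j) (by omega) hT (by rwa [Nat.sub_sub_self hj])
      left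
      simp [this]

/-- If `x` centralizes a nontrivial element of `N`, there is an element of order 6; it generates a
proper subgroup, which gives 5 + 1 free terms. Otherwise `x` acts on `N` without nontrivial fixed
points, and `x` does not commute with its conjugate by a nontrivial `a ∈ N`, although both lie in
the same coset of `N`. -/
theorem hasFree_or_hasAtom_of_normal_two_group [Finite G] {N : Subgroup G} [N.Normal]
    (hN : IsPGroup 2 N) (hbot : N ≠ ⊥) {x : G} (hx : orderOf x = 3) (hG : Nat.card G ≠ 6) :
    HasFree G 6 ∨ HasAtom G 7 := by
  have hx3 : x ^ 3 = 1 := hx ▸ pow_orderOf_eq_one x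
  have hxN : x ∉ N := by
    intro h
    obtain ⟨k, hk⟩ := hN ⟨x, h⟩
    have hk' : x ^ 2 ^ k = 1 := congrArg Subtype.val hk
    have := orderOf_dvd_of_pow_eq_one hk'
    rw [hx] at this
    exact absurd (Nat.prime_three.dvd_of_dvd_pow this) (by norm_num)
  by_cases hfix : ∃ v ∈ N, v ≠ 1 ∧ Commute x v
  · left
    obtain ⟨v, hv, hv1, hxv⟩ := hfix
    obtain ⟨k, hk⟩ := hN ⟨v, hv⟩
    have hk' : v ^ 2 ^ k = 1 := congrArg Subtype.val hk
    obtain ⟨w, hw, hxw⟩ : ∃ w, orderOf w = 2 ∧ Commute x w := by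
      have : Fact (Nat.Prime 2) := ⟨Nat.prime_two⟩
      have hd : 2 ∣ orderOf v := by
        obtain ⟨m, -, hm⟩ := (Nat.dvd_prime_pow Nat.prime_two).1 (orderOf_dvd_of_pow_eq_one hk')
        rw [hm]
        refine dvd_pow_self 2 ?_
        rintro rfl
        exact hv1 (orderOf_eq_one_iff.1 (by simpa using hm))
      refine ⟨v ^ (orderOf v / 2), ?_, hxv.pow_right _⟩
      exact orderOf_pow_orderOf_div (orderOf_pos v).ne' hd
    have h6 : orderOf (x * w) = 6 := by
      rw [hxw.orderOf_mul_eq_mul_orderOf_of_coprime (by rw [hx, hw]; norm_num), hx, hw]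
    refine hasFree_succ_of_lt_orderOf (g := x * w) (k := 5) (by omega) fun h => hG ?_
    rw [← h6, ← Nat.card_zpowers, h, Nat.card_congr Subgroup.topEquiv.toEquiv]
  · right
    push Not at hfix
    obtain ⟨a, ha, ha1⟩ := N.bot_or_exists_ne_one.resolve_left hbot
    have hw : x⁻¹ * (a * x * a⁻¹) ∈ N := by
      have h1 : x⁻¹ * a * x ∈ N := by
        simpa using ‹N.Normal›.conj_mem a ha x⁻¹
      have := N.mul_mem h1 (N.inv_mem ha)
      simpa [mul_assoc] using this
    refine hasAtom_seven_of_order_three (N := N) (g := x) (k := a * x * a⁻¹) hx3 ?_ hxN hw ?_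
    · rw [conj_pow, hx3]; group
    · intro hc
      -- If the conjugate commuted with `x`, this element of `N` would be fixed by `x`, hence
      -- trivial, and `a` itself would commute with `x`.
      have hcw : Commute x (x⁻¹ * (a * x * a⁻¹)) :=
        ((Commute.refl x).inv_right).mul_right hc
      have h1 : x⁻¹ * (a * x * a⁻¹) = 1 := by
        by_contra hne
        exact hfix _ hw hne hcw
      refine hfix a ha ha1 ?_
      rw [inv_mul_eq_one, eq_mul_inv_iff_mul_eq] at h1
      exact h1

/-! ### Olson's bound for abelian `p`-groups -/

theorem pow_eq_zero_add {R : Type*} [CommRing R] {I J : Ideal R} {a b : ℕ}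
    (hI : I ^ (a + 1) = 0) (hJ : J ^ (b + 1) = 0) : (I + J) ^ (a + b + 1) = 0 := by
  rw [add_pow]
  refine Finset.sum_eq_zero fun m hm => ?_
  rcases Nat.lt_or_ge a m with h | h
  · rw [pow_eq_zero_of_le h hI, zero_mul, zero_mul]
  · rw [pow_eq_zero_of_le (m := b + 1) (by omega) hJ, mul_zero, zero_mul]

theorem sum_span_pow_eq_zero {R ι : Type*} [CommRing R] (s : Finset ι) (u : ι → R) (n : ι → ℕ)
    (h : ∀ i ∈ s, u i ^ (n i + 1) = 0) :
    (∑ i ∈ s, Ideal.span {u i}) ^ (∑ i ∈ s, n i + 1) = 0 := by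
  classical
  induction s using Finset.induction_on with
  | empty => simp
  | insert i s hi ih =>
    rw [Finset.sum_insert hi, Finset.sum_insert hi]
    refine pow_eq_zero_add ?_ (ih fun j hj => h j (Finset.mem_insert_of_mem hj))
    rw [Ideal.span_singleton_pow, h i (Finset.mem_insert_self i s), Ideal.zero_eq_bot,
      Ideal.span_singleton_eq_bot]

/-- **Olson's bound**: in an abelian `p`-group generated by elements `g i` with
`g i ^ p ^ e i = 1`, product-one free sequences have length at most `∑ (p ^ e i - 1)`. -/
theorem HasFree.le_sum {p : ℕ} [Fact p.Prime] {G ι : Type*} [CommGroup G] (s : Finset ι)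
    (g : ι → G) (e : ι → ℕ) (hg : ∀ i ∈ s, g i ^ p ^ e i = 1)
    (hcl : Subgroup.closure (g '' s) = ⊤) {k : ℕ} (h : HasFree G k) :
    k ≤ ∑ i ∈ s, (p ^ e i - 1) := by
  classical
  by_contra! hk
  obtain ⟨S, hS, hcard⟩ := h
  let X : G →* MonoidAlgebra (ZMod p) G := MonoidAlgebra.of (ZMod p) G
  have hchar : CharP (MonoidAlgebra (ZMod p) G) p := charP_of_injective_algebraMap' (ZMod p) p
  set J : Ideal (MonoidAlgebra (ZMod p) G) := ∑ i ∈ s, Ideal.span {X (g i) - 1} with hJ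
  -- In characteristic `p`, the `p ^ e i`-th power of `X (g i) - 1` is `X (g i ^ p ^ e i) - 1 = 0`.
  -- Hence the ideal sum is nilpotent of exponent at most `∑ (p ^ e i - 1) + 1 ≤ k`.
  have hJ0 : J ^ k = 0 := by
    refine pow_eq_zero_of_le hk (sum_span_pow_eq_zero s (fun i => X (g i) - 1) _ fun i hi => ?_)
    rw [Nat.sub_add_cancel (Nat.one_le_pow _ _ (Fact.out : p.Prime).pos), sub_pow_char_pow,
      one_pow, ← map_pow, hg i hi, map_one, sub_self]
  have hmem : ∀ x : G, X x - 1 ∈ J := by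
    intro x
    have hx : x ∈ Subgroup.closure (g '' s) := hcl ▸ Subgroup.mem_top x
    induction hx using Subgroup.closure_induction with
    | mem y hy =>
      obtain ⟨i, hi, rfl⟩ := hy
      have hle : Ideal.span {X (g i) - 1} ≤ J :=
        Finset.single_le_sum (f := fun i => Ideal.span {X (g i) - 1}) (fun _ _ => zero_le) hi
      exact hle (Ideal.mem_span_singleton_self _)
    | one => simp
    | mul y z _ _ hy hz =>
      have : X (y * z) - 1 = X y * (X z - 1) + (X y - 1) := by rw [map_mul]; ring
      rw [this]
      exact J.add_mem (J.mul_mem_left _ hz) hy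
    | inv y _ hy =>
      have : X y⁻¹ - 1 = -X y⁻¹ * (X y - 1) := by
        have h1 : X y⁻¹ * X y = 1 := by rw [← map_mul, inv_mul_cancel, map_one]
        linear_combination h1
      rw [this]
      exact J.mul_mem_left _ hy
  induction S using Quotient.inductionOn with
  | h l =>
    have hlen : l.length = k := by simpa using hcard
    have hprod : ∏ i : Fin l.length, (1 + -X (l.get i)) = 0 := by
      have h1 : ∏ i : Fin l.length, (1 + -X (l.get i)) ∈ J ^ k := by
        have h2 := Ideal.prod_mem_prod (s := (Finset.univ : Finset (Fin l.length)))
          (I := fun _ => J) (x := fun i => 1 + -X (l.get i)) (fun i _ => by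
            have : 1 + -X (l.get i) = -(X (l.get i) - 1) := by ring
            rw [this]
            exact J.neg_mem (hmem _))
        rw [Finset.prod_const, Finset.card_univ, Fintype.card_fin] at h2
        exact hlen ▸ h2
      rw [hJ0] at h1
      simpa using h1
    rw [Finset.prod_one_add] at hprod
    have hterm : ∀ t : Finset (Fin l.length),
        (∏ i ∈ t, -X (l.get i)) = MonoidAlgebra.single (∏ i ∈ t, l.get i) ((-1) ^ t.card) := by
      intro t
      rw [Finset.prod_neg, ← map_prod]
      have : ((-1) ^ t.card : MonoidAlgebra (ZMod p) G) = MonoidAlgebra.single 1 ((-1) ^ t.card) := by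
        rw [MonoidAlgebra.one_def, ← MonoidAlgebra.single_neg, MonoidAlgebra.single_pow, one_pow]
      rw [this, MonoidAlgebra.of_apply, MonoidAlgebra.single_mul_single, one_mul, mul_one]
    have hne : ∀ t : Finset (Fin l.length), t ≠ ∅ → ∏ i ∈ t, l.get i ≠ 1 := by
      intro t ht h1
      have hle : t.val.map l.get ≤ (l : Multiset G) := by
        have : (Finset.univ : Finset (Fin l.length)).val.map l.get = l := by
          rw [Fin.univ_def]
          simp
        rw [← this]
        exact Multiset.map_le_map (Finset.val_le_iff.2 (Finset.subset_univ t))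
      have h0 := hS.eq_zero hle ⟨(t.val.map l.get).toList, by simp, by
        rw [← h1, Multiset.prod_toList]; rfl⟩
      exact ht (by simpa using h0)
    -- The vanishing product is expanded over subsets of the terms. Freeness means that only the
    -- empty subset contributes to the coefficient of the identity, so that coefficient is 1, a
    -- contradiction.
    have hcoeff := congrArg (fun r => r.coeff 1) hprod
    simp only [hterm] at hcoeff
    rw [MonoidAlgebra.coeff_sum, Finsupp.finsetSum_apply,
      Finset.sum_eq_single_of_mem ∅ (by simp)] at hcoeff
    · simp at hcoeff
    · intro t _ ht
      rw [MonoidAlgebra.coeff_single, Finsupp.single_eq_of_ne (hne t ht).symm]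

theorem closure_mulSingle {ι : Type*} [Fintype ι] [DecidableEq ι] {n : ℕ} :
    Subgroup.closure (Set.range fun i : ι => (Pi.mulSingle i (Multiplicative.ofAdd 1) : ι → C n))
      = ⊤ := by
  rw [Subgroup.eq_top_iff']
  intro x
  rw [← Finset.univ_prod_mulSingle x]
  refine Subgroup.prod_mem _ fun i _ => ?_
  have : (Pi.mulSingle i (x i) : ι → C n) =
      Pi.mulSingle i (Multiplicative.ofAdd 1) ^ ((Multiplicative.toAdd (x i)).cast : ℤ) := by
    rw [← Pi.mulSingle_zpow, ← ofAdd_zsmul]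
    congr 1
    simp
  rw [this]
  exact Subgroup.zpow_mem _ (Subgroup.subset_closure (Set.mem_range_self i)) _

theorem HasFree.le_of_elementary {p r k : ℕ} [Fact p.Prime] (h : HasFree (Fin r → C p) k) :
    k ≤ r * (p - 1) := by
  have := h.le_sum (p := p) Finset.univ
    (fun i => (Pi.mulSingle i (Multiplicative.ofAdd 1) : Fin r → C p)) (fun _ => 1)
    (fun i _ => by
      rw [pow_one, ← Pi.mulSingle_pow, ← ofAdd_nsmul]; simp)
    (by rw [Finset.coe_univ, Set.image_univ, closure_mulSingle])
  simpa using this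

theorem nonempty_addEquiv_pi {p r : ℕ} [Fact p.Prime] {A : Type*} [AddCommGroup A]
    [Module (ZMod p) A] [Finite A] (hcard : Nat.card A = p ^ r) :
    Nonempty (A ≃+ (Fin r → ZMod p)) := by
  have hrank : Module.finrank (ZMod p) A = r := by
    have h1 : Nat.card A = Nat.card (ZMod p) ^ Module.finrank (ZMod p) A :=
      Module.natCard_eq_pow_finrank
    rw [Nat.card_zmod, hcard] at h1
    exact (Nat.pow_right_injective (Fact.out : p.Prime).two_le h1).symm
  exact ⟨(Module.finBasisOfFinrankEq (ZMod p) A hrank).equivFun.toAddEquiv⟩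

theorem nonempty_mulEquiv_pi {p r : ℕ} [Fact p.Prime] {G : Type*} [Group G]
    (hc : ∀ a b : G, a * b = b * a) (hexp : ∀ x : G, x ^ p = 1) (hcard : Nat.card G = p ^ r) :
    Nonempty (G ≃* (Fin r → C p)) := by
  let _ : CommGroup G := { ‹Group G› with mul_comm := hc }
  let _ : Module (ZMod p) (Additive G) := AddCommGroup.zmodModule fun x => hexp x.toMul
  have : Finite G := Nat.finite_of_card_ne_zero (by
    rw [hcard]; exact pow_ne_zero _ (Fact.out : p.Prime).ne_zero)
  obtain ⟨φ⟩ := nonempty_addEquiv_pi (p := p) (A := Additive G) (r := r) hcard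
  exact ⟨{ toFun := fun x i => Multiplicative.ofAdd (φ (Additive.ofMul x) i)
           invFun := fun y => (φ.symm fun i => Multiplicative.toAdd (y i)).toMul
           left_inv := fun x => φ.symm_apply_apply (Additive.ofMul x)
           right_inv := fun y => funext fun i => congrFun (φ.apply_symm_apply _) i
           map_mul' := fun x y =>
             funext fun i => congrFun (φ.map_add (Additive.ofMul x) (Additive.ofMul y)) i }⟩

/-! ### Lower bounds for `d` and the possible group orders -/

theorem HasFree.of_lt {K L : Subgroup G} {k : ℕ} (h : HasFree K k) (hKL : K < L) :
    HasFree L (k + 1) := by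
  have h1 : HasFree (K.subgroupOf L) k :=
    h.map (Subgroup.subgroupOfEquivOfLe hKL.le).symm.toMonoidHom (MulEquiv.injective _)
  exact h1.succ_of_ne_top fun h => hKL.not_ge (Subgroup.subgroupOf_eq_top.1 h)

theorem hasFree_two [Finite G] (h : 3 ≤ Nat.card G) : HasFree G 2 := by
  have : Nontrivial G := Finite.one_lt_card_iff_nontrivial.1 (by omega)
  obtain ⟨x, hx⟩ := exists_ne (1 : G)
  by_cases ht : Subgroup.zpowers x = ⊤
  · refine hasFree_of_lt_orderOf (g := x) ?_
    rw [← Nat.card_zpowers, ht, Nat.card_congr Subgroup.topEquiv.toEquiv]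
    omega
  · have : Nontrivial (Subgroup.zpowers x) :=
      (Subgroup.nontrivial_iff_ne_bot _).2 (by simpa using hx)
    exact HasFree.succ_of_ne_top (k := 1) hasFree_one ht

/-- Climb a chain of subgroups, each normal of index `p` in the next; each quotient is cyclic of
order `p` and contributes `p - 1` terms. -/
theorem hasFree_of_card_eq_prime_pow {p : ℕ} [hp : Fact p.Prime] [Finite G] {n : ℕ}
    (h : Nat.card G = p ^ n) : HasFree G (n * (p - 1)) := by
  suffices ∀ m ≤ n, ∃ K : Subgroup G, Nat.card K = p ^ m ∧ HasFree K (m * (p - 1)) by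
    obtain ⟨K, -, hK⟩ := this n le_rfl
    exact hK.of_subgroup
  intro m
  induction m with
  | zero => exact fun _ => ⟨⊥, by simp, by simpa using hasFree_zero⟩
  | succ m ih =>
    intro hm
    obtain ⟨K, hK, hfree⟩ := ih (by omega)
    obtain ⟨L, hL, hKL⟩ := Sylow.exists_subgroup_card_pow_succ (p := p) (n := m)
      (h ▸ pow_dvd_pow p hm) hK
    refine ⟨L, hL, ?_⟩
    have hcard : Nat.card (K.subgroupOf L) = p ^ m := by
      rw [Nat.card_congr (Subgroup.subgroupOfEquivOfLe hKL).toEquiv, hK]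
    have hidx : (K.subgroupOf L).index = p := by
      have := (K.subgroupOf L).card_mul_index
      rw [hcard, hL, pow_succ] at this
      exact Nat.eq_of_mul_eq_mul_left (pow_pos hp.out.pos m) this
    have : (K.subgroupOf L).Normal := Subgroup.normal_of_index_eq_minFac_card (by
      rw [hidx, hL, hp.out.pow_minFac (by omega)])
    have h1 : HasFree (K.subgroupOf L) (m * (p - 1)) :=
      hfree.map (Subgroup.subgroupOfEquivOfLe hKL).symm.toMonoidHom (MulEquiv.injective _)
    have h2 : HasFree (L ⧸ K.subgroupOf L) (p - 1) := by
      have hc : Nat.card (L ⧸ K.subgroupOf L) = p := hidx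
      obtain ⟨g, hg⟩ := exists_prime_orderOf_dvd_card' p hc.symm.dvd
      exact hasFree_of_lt_orderOf (g := g) (by rw [hg]; exact Nat.sub_lt hp.out.pos one_pos)
    rw [Nat.succ_mul]
    exact h1.of_quotient h2

/-- Starting the chain at a cyclic group of order 4 gives three terms instead of two, a gain of one
over the general bound for order `2 ^ n`. -/
theorem hasFree_of_card_eq_two_pow [Finite G] {n : ℕ} (h : Nat.card G = 2 ^ n) {a : G}
    (ha : orderOf a = 4) : HasFree G (n + 1) := by
  have : Fact (Nat.Prime 2) := ⟨Nat.prime_two⟩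
  have hn : 2 ≤ n := by
    have := orderOf_dvd_natCard a
    rw [h, ha] at this
    exact (Nat.pow_dvd_pow_iff_le_right (x := 2) (by norm_num)).1 this
  suffices ∀ m, 2 + m ≤ n → ∃ K : Subgroup G, Nat.card K = 2 ^ (2 + m) ∧ HasFree K (3 + m) by
    obtain ⟨K, -, hK⟩ := this (n - 2) (by omega)
    have e : 3 + (n - 2) = n + 1 := by omega
    exact e ▸ hK.of_subgroup
  intro m
  induction m with
  | zero =>
    refine fun _ => ⟨Subgroup.zpowers a, by rw [Nat.card_zpowers, ha]; rfl, ?_⟩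
    exact hasFree_of_lt_orderOf (g := ⟨a, Subgroup.mem_zpowers a⟩) (by simp [ha])
  | succ m ih =>
    intro hm
    obtain ⟨K, hK, hfree⟩ := ih (by omega)
    obtain ⟨L, hL, hKL⟩ := Sylow.exists_subgroup_card_pow_succ (p := 2) (n := 2 + m)
      (h ▸ pow_dvd_pow 2 hm) hK
    refine ⟨L, hL, hfree.of_lt (lt_of_le_of_ne hKL ?_)⟩
    rintro rfl
    have := Nat.pow_right_injective le_rfl (hK.symm.trans hL)
    omega

/-- If `P` is normal, a quotient of order at least 3 adds two terms. If the normalizer lies strictly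
between `P` and `G`, each of the two inclusions adds one. If `P` is its own normalizer, Burnside's
transfer theorem applies because `P` is abelian: there is a normal complement, which adds two terms
when its order is at least 3. -/
theorem card_le_of_sylow [Finite G] {p : ℕ} [hp : Fact p.Prime] (P : Sylow p G)
    [hc : IsMulCommutative (P : Subgroup G)] (hP : HasFree P 4) (hG : ¬ HasFree G 6) :
    Nat.card G ≤ 2 * Nat.card P := by
  by_cases hN : Subgroup.normalizer ((P : Subgroup G) : Set G) = ⊤
  · have : (P : Subgroup G).Normal := Subgroup.normalizer_eq_top_iff.1 hN
    have h1 : Nat.card (G ⧸ (P : Subgroup G)) ≤ 2 := by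
      by_contra! h
      exact hG (hP.of_quotient (hasFree_two h))
    rw [(P : Subgroup G).card_eq_card_quotient_mul_card_subgroup]
    exact Nat.mul_le_mul_right _ h1
  · have hPN : Subgroup.normalizer ((P : Subgroup G) : Set G) = P := by
      by_contra hne
      exact hG ((HasFree.of_lt (K := P) hP
        (lt_of_le_of_ne Subgroup.le_normalizer (Ne.symm hne))).succ_of_ne_top hN)
    have hle : Subgroup.normalizer ((P : Subgroup G) : Set G) ≤
        Subgroup.centralizer ((P : Subgroup G) : Set G) := by
      rw [hPN]
      exact Subgroup.le_centralizer _
    have hcompl := MonoidHom.ker_transferSylow_isComplement' P hle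
    set K := (MonoidHom.transferSylow P hle).ker
    have h1 : Nat.card K ≤ 2 := by
      by_contra! h
      have hQ : HasFree (G ⧸ K) 4 := by
        refine hP.map ((QuotientGroup.mk' K).comp (P : Subgroup G).subtype) ?_
        rw [injective_iff_map_eq_one]
        intro x hx
        have hxK : (x : G) ∈ K := by
          rw [← QuotientGroup.eq_one_iff]; exact hx
        have := hcompl.disjoint.le_bot ⟨hxK, x.2⟩
        exact Subtype.ext (by simpa using this)
      exact hG ((hasFree_two h).of_quotient hQ)
    rw [← hcompl.card_mul_card]
    exact Nat.mul_le_mul_right _ h1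

/-- The subgroup is the core of a Sylow 2-subgroup. The action on its three cosets shows that the
index of the core divides 6, and it is a multiple of 3. -/
theorem exists_normal_of_card_eq_three_mul [Finite G] {a : ℕ} (h : Nat.card G = 3 * 2 ^ a) :
    ∃ N : Subgroup G, N.Normal ∧ (Nat.card N = 2 ^ a ∧ N.index = 3 ∨
      Nat.card N * 2 = 2 ^ a ∧ N.index = 6) := by
  have : Fact (Nat.Prime 2) := ⟨Nat.prime_two⟩
  obtain ⟨P, hP⟩ := Sylow.exists_subgroup_card_pow_prime (G := G) 2 (n := a) (h ▸ Dvd.intro_left 3 rfl)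
  have hidx : P.index = 3 := by
    have := P.card_mul_index
    rw [hP, h, mul_comm] at this
    exact Nat.eq_of_mul_eq_mul_right (pow_pos two_pos a) this
  refine ⟨P.normalCore, P.normalCore_normal, ?_⟩
  have hd : P.normalCore.index ∣ 6 := by
    have : P.normalCore.index ∣ (P.index).factorial := by
      rw [Subgroup.normalCore_eq_ker, Subgroup.index_ker, Subgroup.index_eq_card, ← Nat.card_perm]
      exact Subgroup.card_subgroup_dvd_card (MulAction.toPermHom G (G ⧸ P)).range
    rwa [hidx] at this
  obtain ⟨c, hc⟩ := hidx ▸ Subgroup.index_dvd_of_le P.normalCore_le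
  have hmul := P.normalCore.card_mul_index
  rw [h, hc] at hmul
  have hc' : c ∣ 2 := by
    rw [hc] at hd
    exact Nat.dvd_of_mul_dvd_mul_left (by norm_num : 0 < 3) hd
  rcases (Nat.dvd_prime Nat.prime_two).1 hc' with rfl | rfl
  · exact Or.inl ⟨by omega, by omega⟩
  · exact Or.inr ⟨by omega, by omega⟩

theorem hasFree_of_card_eq_three_mul [Finite G] {a : ℕ} (h : Nat.card G = 3 * 2 ^ a) :
    HasFree G (a + 2) := by
  have : Fact (Nat.Prime 2) := ⟨Nat.prime_two⟩
  have : Fact (Nat.Prime 3) := ⟨Nat.prime_three⟩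
  obtain ⟨N, hN, ⟨h1, h2⟩ | ⟨h1, h2⟩⟩ := exists_normal_of_card_eq_three_mul h
  · have hfree := hasFree_of_card_eq_prime_pow h1
    rw [Nat.add_one_sub_one, mul_one] at hfree
    exact hfree.of_quotient (hasFree_two (by rw [← Subgroup.index_eq_card, h2]))
  · obtain ⟨b, rfl⟩ : ∃ b, a = b + 1 := by
      refine ⟨a - 1, (Nat.succ_pred_eq_of_ne_zero ?_).symm⟩
      rintro rfl
      omega
    have hfree := hasFree_of_card_eq_prime_pow (p := 2) (n := b) (by rw [pow_succ] at h1; omega :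
      Nat.card N = 2 ^ b)
    rw [Nat.add_one_sub_one, mul_one] at hfree
    have hQ : HasFree (G ⧸ N) 3 := by
      rw [Subgroup.index_eq_card] at h2
      obtain ⟨x, hx⟩ := exists_prime_orderOf_dvd_card' (G := G ⧸ N) 3 (by rw [h2]; norm_num)
      refine hasFree_succ_of_lt_orderOf (g := x) (k := 2) (by omega) fun ht => ?_
      have := Nat.card_zpowers x
      rw [ht, Nat.card_congr Subgroup.topEquiv.toEquiv] at this
      omega
    exact (hfree.of_quotient hQ).mono (by omega)

theorem eq_two_pow_mul_three_pow_mul_five_pow {n : ℕ} (hn : n ≠ 0)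
    (h : ∀ p, p.Prime → p ∣ n → p ≤ 6) :
    n = 2 ^ n.factorization 2 * 3 ^ n.factorization 3 * 5 ^ n.factorization 5 := by
  have hsub : n.factorization.support ⊆ {2, 3, 5} := by
    intro p hp
    rw [Nat.support_factorization, Nat.mem_primeFactors] at hp
    have h6 := h p hp.1 hp.2.1
    have : ∀ q ≤ 6, q.Prime → q ∈ ({2, 3, 5} : Finset ℕ) := by decide
    exact this p h6 hp.1
  conv_lhs => rw [← Nat.prod_factorization_pow_eq_self hn]
  rw [Finsupp.prod_of_support_subset _ hsub _ (by simp)]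
  simp [mul_assoc]

/-- The possible orders of groups whose small Davenport constant is at most `5`. -/
theorem card_of_not_hasFree_six [Finite G] (hG : ¬ HasFree G 6) :
    Nat.card G ∈ ({1, 2, 3, 4, 5, 6, 8, 9, 10, 12, 16, 18, 24} : Finset ℕ) ∨
      (Nat.card G = 32 ∧ ∀ x : G, x ^ 2 = 1) := by
  have p2 : Fact (Nat.Prime 2) := ⟨Nat.prime_two⟩
  have p3 : Fact (Nat.Prime 3) := ⟨Nat.prime_three⟩
  have p5 : Fact (Nat.Prime 5) := ⟨Nat.prime_five⟩
  set n := Nat.card G with hn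
  have hn0 : n ≠ 0 := Nat.card_pos.ne'
  have hfac := eq_two_pow_mul_three_pow_mul_five_pow hn0 fun p hp hd => by
    have : Fact p.Prime := ⟨hp⟩
    obtain ⟨g, hg⟩ := exists_prime_orderOf_dvd_card' p hd
    by_contra! h
    exact hG (hasFree_of_lt_orderOf (g := g) (by omega))
  -- Applied to Sylow subgroups this bounds the exponents of 2, 3 and 5 by 5, 2 and 1. A Sylow
  -- 3-subgroup of order 9 or a Sylow 5-subgroup of order 5 has four free terms, which then bounds
  -- `|G|` by 18 or 10 respectively.
  have hbound : ∀ p [Fact p.Prime], n.factorization p * (p - 1) ≤ 5 := by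
    intro p _
    by_contra! h
    have P : Sylow p G := default
    exact hG ((hasFree_of_card_eq_prime_pow P.card_eq_multiplicity).of_subgroup.mono h)
  have h2 := hbound 2
  have h3 := hbound 3
  have h5 := hbound 5
  have P3 : Sylow 3 G := default
  have P5 : Sylow 5 G := default
  have c3 := P3.card_eq_multiplicity
  have c5 := P5.card_eq_multiplicity
  rw [← hn] at c3 c5
  have f3 := hasFree_of_card_eq_prime_pow c3
  have f5 := hasFree_of_card_eq_prime_pow c5
  set a := n.factorization 2
  set b := n.factorization 3
  set c := n.factorization 5
  have hc : c ≤ 1 := by omega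
  have hb : b ≤ 2 := by omega
  have ha : a ≤ 5 := by omega
  clear_value a b c
  rcases Nat.le_one_iff_eq_zero_or_eq_one.1 hc with rfl | rfl
  · interval_cases b
    · rw [pow_zero, pow_zero, mul_one, mul_one] at hfac
      by_cases ha5 : a = 5
      · subst ha5
        refine Or.inr ⟨by omega, fun x => ?_⟩
        obtain ⟨j, -, hj⟩ := (Nat.dvd_prime_pow Nat.prime_two).1 (by
          rw [← hfac]; exact orderOf_dvd_natCard x : orderOf x ∣ 2 ^ 5)
        rcases Nat.lt_or_ge j 2 with hlt | hge
        · rw [← orderOf_dvd_iff_pow_eq_one, hj]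
          exact pow_dvd_pow 2 (Nat.le_of_lt_succ hlt : j ≤ 1)
        · refine absurd (hasFree_of_card_eq_two_pow hfac
            (a := x ^ (orderOf x / 4)) ?_) hG
          refine orderOf_pow_orderOf_div (orderOf_pos x).ne' ?_
          rw [hj]
          exact pow_dvd_pow 2 hge
      · left
        have : a ≤ 4 := by omega
        rw [hfac]
        interval_cases a <;> simp
    · rw [pow_one, pow_zero, mul_one, mul_comm] at hfac
      have : a ≤ 3 := by
        by_contra! h
        exact hG ((hasFree_of_card_eq_three_mul hfac).mono (by omega))
      left
      rw [hfac]
      interval_cases a <;> simp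
    · have : IsMulCommutative (P3 : Subgroup G) :=
        IsPGroup.isMulCommutative_of_card_eq_prime_sq c3
      have hle := card_le_of_sylow P3 f3 hG
      rw [c3, ← hn] at hle
      left
      interval_cases a <;> simp at hfac <;> first | omega | simp [hfac]
  · have : IsMulCommutative (P5 : Subgroup G) := by
      have := isCyclic_of_prime_card (α := P5) (p := 5) (by simpa using c5)
      infer_instance
    have hle := card_le_of_sylow P5 f5 hG
    rw [c5, ← hn] at hle
    left
    interval_cases a <;> interval_cases b <;> simp at hfac <;> first | omega | simp [hfac]

/-! ### Non-abelian groups of order 16 and groups of order `3 * 2 ^ a` -/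

/-- A cyclic central quotient forces commutativity, and every group of order at most 3 is cyclic. -/
theorem four_mul_card_center_le [Finite G] (hnc : ¬ ∀ a b : G, a * b = b * a) :
    4 * Nat.card (Subgroup.center G) ≤ Nat.card G := by
  rw [(Subgroup.center G).card_eq_card_quotient_mul_card_subgroup]
  refine Nat.mul_le_mul_right _ ?_
  by_contra! h
  apply hnc
  have hpos : 0 < Nat.card (G ⧸ Subgroup.center G) := Nat.card_pos
  have : IsCyclic (G ⧸ Subgroup.center G) := by
    have hcases : Nat.card (G ⧸ Subgroup.center G) = 1 ∨ Nat.card (G ⧸ Subgroup.center G) = 2 ∨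
        Nat.card (G ⧸ Subgroup.center G) = 3 := by omega
    rcases hcases with h | h | h
    · have := (Nat.card_eq_one_iff_unique.1 h).1
      infer_instance
    · have : Fact (Nat.Prime 2) := ⟨Nat.prime_two⟩
      exact isCyclic_of_prime_card h
    · have : Fact (Nat.Prime 3) := ⟨Nat.prime_three⟩
      exact isCyclic_of_prime_card h
  exact (MonoidHom.isMulCommutative_of_isCyclic_of_ker_le_center
    (QuotientGroup.mk' (Subgroup.center G)) (by simp)).is_comm.comm

theorem exists_pow_eq_of_mem_zpowers [Finite G] {g y : G} (h : y ∈ Subgroup.zpowers g) :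
    ∃ k < orderOf g, g ^ k = y := by
  classical
  simpa using mem_zpowers_iff_mem_range_orderOf.1 h

theorem hasFree_zpowers {g : G} {k : ℕ} (h : k < orderOf g) :
    HasFree (Subgroup.zpowers g) k :=
  hasFree_of_lt_orderOf (g := ⟨g, Subgroup.mem_zpowers g⟩) (by simpa using h)

theorem mul_comm_of_sq_eq_one (h : ∀ x : G, x ^ 2 = 1) (a b : G) : a * b = b * a := by
  have h1 := h (a * b)
  have ha : a⁻¹ = a := inv_eq_of_mul_eq_one_right (by rw [← pow_two, h])
  have hb : b⁻¹ = b := inv_eq_of_mul_eq_one_right (by rw [← pow_two, h])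
  rw [pow_two] at h1
  calc a * b = (a * b)⁻¹ := (inv_eq_of_mul_eq_one_right h1).symm
    _ = b * a := by rw [mul_inv_rev, ha, hb]

theorem sq_eq_one_or_orderOf_eq_four [Finite G] {n : ℕ} (hcard : Nat.card G = 2 ^ n) (hG : ¬ HasFree G 6)
    (g : G) : g ^ 2 = 1 ∨ orderOf g = 4 := by
  obtain ⟨j, hj, hgj⟩ := (Nat.dvd_prime_pow Nat.prime_two).1
    (hcard ▸ orderOf_dvd_natCard g : orderOf g ∣ 2 ^ n)
  have hle : orderOf g ≤ 6 := by
    by_contra! h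
    exact hG (hasFree_of_lt_orderOf (g := g) h)
  have hj2 : j ≤ 2 := by
    by_contra! h
    have := Nat.pow_le_pow_right (n := 2) (by norm_num) h
    rw [← hgj] at this
    omega
  interval_cases j
  · left; rw [orderOf_eq_one_iff.1 (hgj.trans (pow_zero 2)), one_pow]
  · left; rw [← orderOf_dvd_iff_pow_eq_one, hgj, pow_one]
  · right; exact hgj

theorem hasAtom_seven_of_card_sixteen [Finite G] (hcard : Nat.card G = 16)
    (hnc : ¬ ∀ a b : G, a * b = b * a) (hG : ¬ HasFree G 6) : HasAtom G 7 := by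
  have hZ := four_mul_card_center_le hnc
  have hord := sq_eq_one_or_orderOf_eq_four (n := 4) hcard hG
  -- Such `a` and `c` generate an abelian subgroup with four free terms, while the centre has order
  -- at most 4. Otherwise each element of order 4 has only its own powers as centralizer, and this
  -- is refuted below.
  by_cases hex : ∃ a c : G, orderOf a = 4 ∧ Commute a c ∧ c ∉ Subgroup.zpowers a
  · obtain ⟨a, c, ha, hac, hc⟩ := hex
    set K : Subgroup G := Subgroup.closure {a, c}
    have hK : IsMulCommutative K := by
      refine Subgroup.isMulCommutative_closure ?_
      rintro x (rfl | rfl) y (rfl | rfl)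
      exacts [rfl, hac, hac.symm, rfl]
    have hlt : Subgroup.zpowers a < K := by
      refine SetLike.lt_iff_le_and_exists.2 ⟨?_, c, Subgroup.subset_closure (by simp), hc⟩
      exact (Subgroup.zpowers_le).2 (Subgroup.subset_closure (by simp))
    have hfree : HasFree K 4 :=
      HasFree.of_lt (hasFree_zpowers (g := a) (k := 3) (by omega)) hlt
    exact hasAtom_of_isMulCommutative hfree (by omega)
  · exfalso
    push Not at hex
    have p2 : Fact (Nat.Prime 2) := ⟨Nat.prime_two⟩
    have hpG : IsPGroup 2 G := IsPGroup.of_card (n := 4) hcard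
    have : Nontrivial G := Finite.one_lt_card_iff_nontrivial.1 (by omega)
    have hcn := hpG.center_nontrivial
    obtain ⟨z, hz, hz1⟩ := (Subgroup.nontrivial_iff_exists_ne_one _).1 hcn
    have hzc : ∀ g, Commute g z := fun g => Subgroup.mem_center_iff.1 hz g
    have hz4 : orderOf z ≠ 4 := by
      intro h4
      apply hnc
      have key : ∀ g, g ∈ Subgroup.zpowers z := fun g => hex z g h4 (hzc g).symm
      intro a b
      obtain ⟨i, rfl⟩ := key a
      obtain ⟨j, rfl⟩ := key b
      exact ((Commute.refl z).zpow_zpow i j).eq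
    have hz2 : z ^ 2 = 1 := (hord z).resolve_right hz4
    -- The central involution `z` is a power of every element of order 4, so all squares lie in `{1,
    -- z}`. Commutators then lie there too, the centralizer of `a` has index 2 and order 8, but it
    -- is contained in a group of order 4.
    have hsq : ∀ g : G, g ^ 2 = 1 ∨ g ^ 2 = z := by
      intro g
      refine (hord g).imp_right fun hg => ?_
      obtain ⟨k, hk, hgk⟩ := exists_pow_eq_of_mem_zpowers (hex g z hg (hzc g))
      rw [hg] at hk
      have h2 : orderOf g ∣ k * 2 := orderOf_dvd_of_pow_eq_one (by rw [pow_mul, hgk, hz2])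
      rw [hg] at h2
      interval_cases k
      · exact absurd (by simpa using hgk.symm) hz1
      · omega
      · exact hgk
      · omega
    obtain ⟨a, ha⟩ : ∃ a : G, orderOf a = 4 := by
      by_contra! h
      exact hnc (mul_comm_of_sq_eq_one fun x => (hord x).resolve_right (h x))
    have hzinv : z⁻¹ = z := inv_eq_of_mul_eq_one_right (by rw [← pow_two, hz2])
    have hinv : ∀ g : G, g⁻¹ = g ∨ g⁻¹ = z * g := by
      intro g
      rcases hsq g with h | h
      · exact Or.inl (inv_eq_of_mul_eq_one_right (by rw [← pow_two, h]))
      · refine Or.inr (inv_eq_of_mul_eq_one_right ?_)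
        rw [← mul_assoc, (hzc g).eq, mul_assoc, ← pow_two, h, ← pow_two, hz2]
    have hcomm : ∀ g : G, g * a = a * g ∨ g * a = z * (a * g) := by
      intro g
      have hzz : ∀ y : G, z * (z * y) = y := fun y => by
        rw [← mul_assoc, ← pow_two, hz2, one_mul]
      have hza : a * z = z * a := (hzc a).eq
      have hzg : ∀ y, a * (z * y) = z * (a * y) := fun y => by
        rw [← mul_assoc, hza, mul_assoc]
      have e : g * a = ((a⁻¹) * g⁻¹)⁻¹ := by group
      rcases hinv (a⁻¹ * g⁻¹) with h | h <;> rcases hinv a with h' | h' <;>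
        rcases hinv g with h'' | h'' <;>
        simp only [h', h'', mul_assoc, hzz, hzg] at h e <;>
        first
          | exact Or.inl (e.trans h)
          | exact Or.inr (e.trans h)
    have hCle : Subgroup.centralizer {a} ≤ Subgroup.zpowers a := fun c hc =>
      hex a c ha (Subgroup.mem_centralizer_singleton_iff.1 hc).symm
    have hCcard : Nat.card (Subgroup.centralizer {a}) ≤ 4 := by
      rw [← ha, ← Nat.card_zpowers]
      exact Subgroup.card_le_of_le hCle
    obtain ⟨g, hg⟩ : ∃ g, g ∉ Subgroup.centralizer {a} := by
      by_contra! h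
      have htop : Subgroup.centralizer {a} = ⊤ := (Subgroup.eq_top_iff' _).2 h
      rw [htop, Nat.card_congr Subgroup.topEquiv.toEquiv] at hCcard
      omega
    have hidx : (Subgroup.centralizer {a}).index = 2 := by
      rw [Subgroup.index_eq_two_iff]
      refine ⟨g, fun b => ?_⟩
      by_cases hb : b ∈ Subgroup.centralizer {a}
      · exact Or.inr ⟨hb, fun h => hg ((Subgroup.mul_mem_cancel_left _ hb).1 h)⟩
      · refine Or.inl ⟨?_, hb⟩
        rw [Subgroup.mem_centralizer_singleton_iff] at *
        have h1 := (hcomm g).resolve_left hg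
        have h2 := (hcomm b).resolve_left hb
        calc b * g * a = b * (z * (a * g)) := by rw [mul_assoc, h1]
          _ = z * (b * a) * g := by simp only [← mul_assoc, (hzc b).eq]
          _ = z ^ 2 * (a * b * g) := by rw [h2]; simp only [pow_two, mul_assoc]
          _ = a * (b * g) := by rw [hz2, one_mul, mul_assoc]
    have := (Subgroup.centralizer {a}).card_mul_index
    rw [hidx, hcard] at this
    omega

theorem hasFree_or_hasAtom_of_card_eq_three_mul [Finite G] {a : ℕ} (ha : 2 ≤ a)
    (h : Nat.card G = 3 * 2 ^ a) : HasFree G 6 ∨ HasAtom G 7 := by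
  have p3 : Fact (Nat.Prime 3) := ⟨Nat.prime_three⟩
  have p2 : Fact (Nat.Prime 2) := ⟨Nat.prime_two⟩
  obtain ⟨N, hN, hN'⟩ := exists_normal_of_card_eq_three_mul h
  obtain ⟨x, hx⟩ := exists_prime_orderOf_dvd_card' (G := G) 3 (h ▸ Dvd.intro _ rfl)
  obtain ⟨b, rfl⟩ : ∃ b, a = b + 2 := ⟨a - 2, by omega⟩
  have hpos : 0 < 2 ^ b := by positivity
  have hcard : Nat.card N = 2 ^ (b + 2) ∨ Nat.card N = 2 ^ (b + 1) := by
    rcases hN' with ⟨h, -⟩ | ⟨h, -⟩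
    · exact Or.inl h
    · rw [pow_succ] at h
      exact Or.inr (by omega)
  refine hasFree_or_hasAtom_of_normal_two_group (N := N) ?_ ?_ hx ?_
  · rcases hcard with h | h
    · exact IsPGroup.of_card h
    · exact IsPGroup.of_card h
  · rintro rfl
    rw [Subgroup.card_bot] at hcard
    simp only [pow_add] at hcard
    omega
  · rw [h, pow_add]
    omega

/-! ### Recognizing dihedral and quaternion groups -/

theorem pow_val_add {a : G} {n : ℕ} [NeZero n] (ha : a ^ n = 1) (i j : ZMod n) :
    a ^ (i + j).val = a ^ i.val * a ^ j.val := by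
  rw [ZMod.val_add, ← pow_add, ← pow_mod_orderOf a (i.val + j.val),
    ← pow_mod_orderOf a ((i.val + j.val) % n),
    Nat.mod_mod_of_dvd _ (orderOf_dvd_of_pow_eq_one ha)]

theorem pow_val_neg {a : G} {n : ℕ} [NeZero n] (ha : a ^ n = 1) (i : ZMod n) :
    a ^ (-i).val = (a ^ i.val)⁻¹ := by
  rw [eq_inv_iff_mul_eq_one, ← pow_val_add ha, neg_add_cancel, ZMod.val_zero, pow_zero]

theorem pow_val_mul_of_conj {a x : G} {n : ℕ} [NeZero n] (ha : a ^ n = 1)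
    (hxa : x * a * x⁻¹ = a⁻¹) (i : ZMod n) : a ^ i.val * x = x * a ^ (-i).val := by
  have h : x * a ^ (-i).val * x⁻¹ = a ^ i.val := by
    rw [← conj_pow, hxa, inv_pow, ← pow_val_neg ha, neg_neg]
  rw [← h, inv_mul_cancel_right]

theorem pow_val_eq_one {a : G} {n : ℕ} [NeZero n] (ha : orderOf a = n) {i : ZMod n}
    (h : a ^ i.val = 1) : i = 0 := by
  have h1 := orderOf_dvd_of_pow_eq_one h
  rw [ha] at h1
  exact (ZMod.val_eq_zero i).1 (Nat.eq_zero_of_dvd_of_lt h1 i.val_lt)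

theorem nonempty_mulEquiv_dihedralGroup {n : ℕ} [NeZero n] [Finite G] {a x : G}
    (ha : orderOf a = n) (hx : x ∉ Subgroup.zpowers a) (hx2 : x ^ 2 = 1)
    (hxa : x * a * x⁻¹ = a⁻¹) (hcard : Nat.card G = 2 * n) :
    Nonempty (G ≃* DihedralGroup n) := by
  have han : a ^ n = 1 := ha ▸ pow_orderOf_eq_one a
  have hmul := pow_val_mul_of_conj han hxa
  have hadd := pow_val_add han
  let φ : DihedralGroup n →* G :=
    { toFun := fun g => match g with
        | .r i => a ^ i.val
        | .sr i => x * a ^ i.val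
      map_one' := by
        change a ^ (0 : ZMod n).val = 1
        simp
      map_mul' := by
        rintro (i | i) (j | j)
        · exact hadd i j
        · change x * a ^ (j - i).val = a ^ i.val * (x * a ^ j.val)
          rw [← mul_assoc, hmul, mul_assoc, ← hadd, neg_add_eq_sub]
        · change x * a ^ (i + j).val = x * a ^ i.val * a ^ j.val
          rw [mul_assoc, ← hadd]
        · change a ^ (j - i).val = x * a ^ i.val * (x * a ^ j.val)
          rw [← mul_assoc, mul_assoc x, hmul, ← mul_assoc, ← pow_two, hx2, one_mul, ← hadd,
            neg_add_eq_sub] }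
  have hinj : Function.Injective φ := by
    rw [injective_iff_map_eq_one]
    rintro (i | i) hi
    · rw [pow_val_eq_one ha hi]; rfl
    · refine absurd ?_ hx
      have h1 : x * a ^ i.val = 1 := hi
      rw [mul_eq_one_iff_eq_inv.1 h1]
      exact Subgroup.inv_mem _ (Subgroup.npow_mem_zpowers a _)
  exact ⟨(MulEquiv.ofBijective φ ((Nat.bijective_iff_injective_and_card φ).2
    ⟨hinj, by rw [DihedralGroup.nat_card, hcard]⟩)).symm⟩

theorem nonempty_mulEquiv_quaternionGroup {n : ℕ} [NeZero n] [Finite G] {a x : G}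
    (ha : orderOf a = 2 * n) (hx : x ∉ Subgroup.zpowers a) (hx2 : x ^ 2 = a ^ n)
    (hxa : x * a * x⁻¹ = a⁻¹) (hcard : Nat.card G = 4 * n) :
    Nonempty (G ≃* QuaternionGroup n) := by
  have han : a ^ (2 * n) = 1 := ha ▸ pow_orderOf_eq_one a
  have hmul := pow_val_mul_of_conj han hxa
  have hadd := pow_val_add han
  have hx2' : x ^ 2 = a ^ (n : ZMod (2 * n)).val := by
    rw [hx2, ZMod.val_natCast, Nat.mod_eq_of_lt]
    have := NeZero.pos n
    omega
  let φ : QuaternionGroup n →* G :=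
    { toFun := fun g => match g with
        | .a i => a ^ i.val
        | .xa i => x * a ^ i.val
      map_one' := by
        change a ^ (0 : ZMod (2 * n)).val = 1
        simp
      map_mul' := by
        rintro (i | i) (j | j)
        · exact hadd i j
        · change x * a ^ (j - i).val = a ^ i.val * (x * a ^ j.val)
          rw [← mul_assoc, hmul, mul_assoc, ← hadd, neg_add_eq_sub]
        · change x * a ^ (i + j).val = x * a ^ i.val * a ^ j.val
          rw [mul_assoc, ← hadd]
        · change a ^ ((n : ZMod (2 * n)) + j - i).val = x * a ^ i.val * (x * a ^ j.val)
          rw [← mul_assoc, mul_assoc x, hmul, ← mul_assoc, ← pow_two, hx2', ← hadd, ← hadd]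
          congr 2
          ring }
  have hinj : Function.Injective φ := by
    rw [injective_iff_map_eq_one]
    rintro (i | i) hi
    · rw [pow_val_eq_one ha hi]; rfl
    · refine absurd ?_ hx
      have h1 : x * a ^ i.val = 1 := hi
      rw [mul_eq_one_iff_eq_inv.1 h1]
      exact Subgroup.inv_mem _ (Subgroup.npow_mem_zpowers a _)
  exact ⟨(MulEquiv.ofBijective φ ((Nat.bijective_iff_injective_and_card φ).2
    ⟨hinj, by rw [Nat.card_eq_fintype_card, QuaternionGroup.card, hcard]⟩)).symm⟩

/-- If they commuted, the cyclic subgroup of index 2 would be central, against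
`four_mul_card_center_le`. -/
theorem not_commute_of_index_two [Finite G] (hnc : ¬ ∀ a b : G, a * b = b * a) {a x : G}
    (hidx : (Subgroup.zpowers a).index = 2) (hx : x ∉ Subgroup.zpowers a) : ¬ Commute x a := by
  intro hxa
  have hle : Subgroup.zpowers a ≤ Subgroup.center G := by
    rw [Subgroup.zpowers_le, Subgroup.mem_center_iff]
    have hK : ∀ g ∈ Subgroup.zpowers a, Commute g a := by
      rintro _ ⟨k, rfl⟩
      exact (Commute.refl a).zpow_left k
    intro g
    by_cases hg : g ∈ Subgroup.zpowers a
    · exact hK g hg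
    · have h1 : x⁻¹ * g ∈ Subgroup.zpowers a := by
        rw [Subgroup.mul_mem_iff_of_index_two hidx, Subgroup.inv_mem_iff]
        simp [hx, hg]
      have := hxa.mul_left (hK _ h1)
      rwa [mul_inv_cancel_left] at this
  have h1 := four_mul_card_center_le hnc
  have h2 := Subgroup.card_le_of_le hle
  have h3 := (Subgroup.zpowers a).card_mul_index
  rw [hidx] at h3
  have h4 : 0 < Nat.card (Subgroup.zpowers a) := Nat.card_pos
  omega

theorem nonempty_mulEquiv_of_card_six [Finite G] (hcard : Nat.card G = 6)
    (hnc : ¬ ∀ a b : G, a * b = b * a) : Nonempty (G ≃* DihedralGroup 3) := by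
  have p3 : Fact (Nat.Prime 3) := ⟨Nat.prime_three⟩
  have p2 : Fact (Nat.Prime 2) := ⟨Nat.prime_two⟩
  obtain ⟨a, ha⟩ := exists_prime_orderOf_dvd_card' (G := G) 3 (hcard ▸ by norm_num)
  obtain ⟨x, hx⟩ := exists_prime_orderOf_dvd_card' (G := G) 2 (hcard ▸ by norm_num)
  have hidx : (Subgroup.zpowers a).index = 2 := by
    have := (Subgroup.zpowers a).card_mul_index
    rw [Nat.card_zpowers, ha, hcard] at this
    omega
  have hxa : x ∉ Subgroup.zpowers a := by
    intro h
    have := orderOf_dvd_of_mem_zpowers h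
    rw [hx, ha] at this
    omega
  have hnorm := Subgroup.normal_of_index_eq_two hidx
  have hconj := hnorm.conj_mem a (Subgroup.mem_zpowers a) x
  obtain ⟨k, hk, hak⟩ := exists_pow_eq_of_mem_zpowers hconj
  rw [ha] at hk
  have hncx := not_commute_of_index_two hnc hidx hxa
  refine nonempty_mulEquiv_dihedralGroup ha hxa (hx ▸ pow_orderOf_eq_one x) ?_ (by omega)
  interval_cases k
  · refine absurd ?_ hncx
    have : a = 1 := by simpa using hak.symm
    rw [this]
    exact Commute.one_right x
  · refine absurd ?_ hncx
    rw [pow_one, eq_mul_inv_iff_mul_eq] at hak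
    exact hak.symm
  · rw [← hak, eq_inv_iff_mul_eq_one, ← pow_succ]
    exact (congrArg (a ^ ·) ha).symm.trans (pow_orderOf_eq_one a)

theorem exists_orderOf_eq_four [Finite G] (hcard : Nat.card G = 8)
    (hnc : ¬ ∀ a b : G, a * b = b * a) : ∃ a : G, orderOf a = 4 := by
  by_contra! h
  refine hnc (mul_comm_of_sq_eq_one fun x => ?_)
  have hd : orderOf x ∣ 2 ^ 3 := by
    have := orderOf_dvd_natCard x
    rwa [hcard] at this
  obtain ⟨j, hj, hxj⟩ := (Nat.dvd_prime_pow Nat.prime_two).1 hd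
  interval_cases j
  · rw [orderOf_eq_one_iff.1 (hxj.trans (pow_zero 2)), one_pow]
  · rw [← orderOf_dvd_iff_pow_eq_one, hxj, pow_one]
  · exact absurd hxj (h x)
  · have := isCyclic_of_orderOf_eq_card x (by rw [hxj, hcard]; rfl)
    exact absurd ((inferInstance : IsMulCommutative G).is_comm.comm) hnc

theorem nonempty_mulEquiv_of_card_eight [Finite G] (hcard : Nat.card G = 8)
    (hnc : ¬ ∀ a b : G, a * b = b * a) :
    Nonempty (G ≃* QuaternionGroup 2) ∨ Nonempty (G ≃* DihedralGroup 4) := by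
  obtain ⟨a, ha⟩ := exists_orderOf_eq_four hcard hnc
  have hidx : (Subgroup.zpowers a).index = 2 := by
    have := (Subgroup.zpowers a).card_mul_index
    rw [Nat.card_zpowers, ha, hcard] at this
    omega
  obtain ⟨x, hxa⟩ : ∃ x, x ∉ Subgroup.zpowers a := by
    by_contra! h
    rw [(Subgroup.eq_top_iff' _).2 h, Subgroup.index_top] at hidx
    omega
  have hncx := not_commute_of_index_two hnc hidx hxa
  have hnorm := Subgroup.normal_of_index_eq_two hidx
  have hconj := hnorm.conj_mem a (Subgroup.mem_zpowers a) x
  obtain ⟨k, hk, hak⟩ := exists_pow_eq_of_mem_zpowers hconj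
  rw [ha] at hk
  have ha4 : a ^ 4 = 1 := ha ▸ pow_orderOf_eq_one a
  have hinv : a ^ 3 = a⁻¹ := by
    rw [eq_inv_iff_mul_eq_one, ← pow_succ, ha4]
  have hxax : x * a * x⁻¹ = a⁻¹ := by
    interval_cases k
    · refine absurd ?_ hncx
      have : a = 1 := by simpa using hak.symm
      rw [this]
      exact Commute.one_right x
    · refine absurd ?_ hncx
      rw [pow_one, eq_mul_inv_iff_mul_eq] at hak
      exact hak.symm
    · have h1 : (x * a * x⁻¹) ^ 2 = 1 := by rw [← hak, ← pow_mul, ha4]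
      rw [conj_pow, conj_eq_one_iff] at h1
      have := orderOf_dvd_of_pow_eq_one h1
      rw [ha] at this
      omega
    · rw [← hak, hinv]
  -- The square of `x` commutes with `x`, which rules out `a` and `a⁻¹`. The value 1 gives the
  -- dihedral group and `a ^ 2` the quaternion group.
  obtain ⟨m, hm, ham⟩ := exists_pow_eq_of_mem_zpowers
    (Subgroup.sq_mem_of_index_two hidx x)
  rw [ha] at hm
  have hxx : Commute x (a ^ m) := by
    rw [ham]
    exact (Commute.refl x).pow_right 2
  interval_cases m
  · exact Or.inr (nonempty_mulEquiv_dihedralGroup ha hxa (by simpa using ham.symm) hxax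
      (by omega))
  · exact absurd (by simpa using hxx) hncx
  · exact Or.inl (nonempty_mulEquiv_quaternionGroup (n := 2) ha hxa ham.symm hxax (by omega))
  · rw [hinv] at hxx
    exact absurd (by simpa using hxx.inv_right) hncx

/-! ### Non-abelian groups without atoms of length at least seven -/

theorem nonempty_mulEquiv_of_not_hasAtom [Finite G] (hnc : ¬ ∀ a b : G, a * b = b * a)
    (hG : ¬ HasAtom G 7) :
    Nonempty (G ≃* DihedralGroup 3) ∨ Nonempty (G ≃* QuaternionGroup 2) ∨
      Nonempty (G ≃* DihedralGroup 4) := by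
  have hfree : ¬ HasFree G 6 := fun h => hG h.hasAtom
  have p2 : Fact (Nat.Prime 2) := ⟨Nat.prime_two⟩
  have p3 : Fact (Nat.Prime 3) := ⟨Nat.prime_three⟩
  have p5 : Fact (Nat.Prime 5) := ⟨Nat.prime_five⟩
  have hZ := four_mul_card_center_le hnc
  have hZ1 : 0 < Nat.card (Subgroup.center G) := Nat.card_pos
  have hsq : ∀ p [Fact p.Prime], Nat.card G ≠ p ^ 2 := fun p _ h =>
    hnc (IsPGroup.isMulCommutative_of_card_eq_prime_sq h).is_comm.comm
  have h12 : ∀ a, 2 ≤ a → Nat.card G ≠ 3 * 2 ^ a := fun a ha h =>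
    (hasFree_or_hasAtom_of_card_eq_three_mul ha h).elim hfree hG
  rcases card_of_not_hasFree_six hfree with h | ⟨-, h⟩
  · simp only [Finset.mem_insert, Finset.mem_singleton] at h
    rcases h with h | h | h | h | h | h | h | h | h | h | h | h | h
    · omega
    · omega
    · omega
    · exact absurd h (hsq 2)
    · have := isCyclic_of_prime_card (p := 5) h
      exact absurd ((inferInstance : IsMulCommutative G).is_comm.comm) hnc
    · exact Or.inl (nonempty_mulEquiv_of_card_six h hnc)
    · exact Or.inr (nonempty_mulEquiv_of_card_eight h hnc)
    · exact absurd h (hsq 3)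
    -- In order 10 a subgroup of order 5, and in order 18 one of order 9, carries four free terms;
    -- the centre has order at most 4, so there is an atom of length at least 7.
    · obtain ⟨a, ha⟩ := exists_prime_orderOf_dvd_card' (G := G) 5 (h ▸ by norm_num)
      exact absurd (hasAtom_of_isMulCommutative
        (hasFree_zpowers (g := a) (k := 4) (by omega)) (by omega)) hG
    · exact absurd h (h12 2 le_rfl)
    · exact absurd (hasAtom_seven_of_card_sixteen h hnc hfree) hG
    · obtain ⟨P, hP⟩ := Sylow.exists_subgroup_card_pow_prime (G := G) 3 (n := 2)
        (h ▸ by norm_num)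
      have := IsPGroup.isMulCommutative_of_card_eq_prime_sq hP
      exact absurd (hasAtom_of_isMulCommutative (K := P) (k := 4)
        (hasFree_of_card_eq_prime_pow hP) (by omega)) hG
    · exact absurd h (h12 3 (by norm_num))
  · exact absurd (mul_comm_of_sq_eq_one h) hnc

/-! ### Upper bounds in order eight -/

theorem mul_eq_one_of_card_eq_two {N : Subgroup G} (hN : Nat.card N = 2) {u v : G} (hu : u ∈ N)
    (hv : v ∈ N) (hu1 : u ≠ 1) (hv1 : v ≠ 1) : u * v = 1 := by
  obtain ⟨w, -, hw⟩ := (Nat.card_eq_two_iff' (1 : N)).1 hN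
  have h1 := hw ⟨u, hu⟩ fun h => hu1 (congrArg Subtype.val h)
  have h2 := hw ⟨v, hv⟩ fun h => hv1 (congrArg Subtype.val h)
  have huv : u = v := congrArg Subtype.val (h1.trans h2.symm)
  have h3 : (⟨u, hu⟩ : N) ^ 2 = 1 := hN ▸ pow_card_eq_one'
  rw [← huv, ← pow_two]
  exact congrArg Subtype.val h3

/-- Among five terms two share one of the four cosets, and their product lies in `N`. The other
three contain a nonempty subsequence with product in `N`, as `d = 2` for the Klein group. In a group
of order 2, one of these products is 1 or their product is. -/
theorem not_hasFree_five [Finite G] {N : Subgroup G} [N.Normal] (hN : Nat.card N = 2)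
    (hQ : Nat.card (G ⧸ N) = 4) (hsq : ∀ q : G ⧸ N, q ^ 2 = 1) : ¬ HasFree G 5 := by
  have p2 : Fact (Nat.Prime 2) := ⟨Nat.prime_two⟩
  rintro ⟨S, hS, hcard⟩
  have hfreeQ : ∀ R : Multiset G, Multiset.card R = 3 →
      ∃ l : List G, (l : Multiset G) ≤ R ∧ l ≠ [] ∧ l.prod ∈ N := by
    intro R hR
    have h1 : ¬ IsProductOneFree (R.map (QuotientGroup.mk' N)) := by
      intro h
      obtain ⟨φ⟩ := nonempty_mulEquiv_pi (p := 2) (r := 2) (mul_comm_of_sq_eq_one hsq) hsq hQ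
      have h3 : HasFree (G ⧸ N) 3 := ⟨_, h, by rw [Multiset.card_map, hR]⟩
      have := (h3.map φ.toMonoidHom φ.injective).le_of_elementary
      omega
    contrapose! h1
    rw [isProductOneFree_iff]
    intro l hl hl1
    obtain ⟨l', hl', rfl⟩ := exists_list_map_eq hl
    by_contra hne
    refine h1 l' hl' (by simpa using hne) ?_
    rw [← QuotientGroup.eq_one_iff]
    rwa [← map_list_prod] at hl1
  have hdup : ¬ (S.map (QuotientGroup.mk' N)).Nodup := by
    intro hnd
    have := Fintype.ofFinite (G ⧸ N)
    classical
    have h1 := Finset.card_le_univ (⟨S.map (QuotientGroup.mk' N), hnd⟩ : Finset (G ⧸ N))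
    rw [Finset.card_mk, Multiset.card_map, hcard, ← Nat.card_eq_fintype_card, hQ] at h1
    omega
  rw [Multiset.nodup_iff_le] at hdup
  push Not at hdup
  obtain ⟨q, hq⟩ := hdup
  obtain ⟨l, hl, hlq⟩ := exists_list_map_eq (l := [q, q]) hq
  obtain ⟨a, b, rfl⟩ : ∃ a b, l = [a, b] := by
    rw [← List.length_eq_two, ← List.length_map (QuotientGroup.mk' N), ← hlq]
    rfl
  have hab : a * b ∈ N := by
    rw [← QuotientGroup.eq_one_iff, QuotientGroup.mk_mul]
    simp only [List.map_cons, List.map_nil, List.cons.injEq] at hlq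
    have ha : (a : G ⧸ N) = q := hlq.1.symm
    have hb : (b : G ⧸ N) = q := hlq.2.1.symm
    rw [ha, hb, ← pow_two, hsq]
  obtain ⟨R, rfl⟩ := Multiset.le_iff_exists_add.1 hl
  obtain ⟨m, hm, hm0, hmN⟩ := hfreeQ R (by simp at hcard; omega)
  rw [isProductOneFree_iff] at hS
  by_cases h1 : a * b = 1
  · exact absurd (hS [a, b] hl (by simpa using h1)) (by simp)
  by_cases h2 : m.prod = 1
  · exact hm0 (hS m (hm.trans (Multiset.le_add_left _ _)) h2)
  have h3 := mul_eq_one_of_card_eq_two hN hab hmN h1 h2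
  exact absurd (hS ([a, b] ++ m) (by rw [← Multiset.coe_add]; exact add_le_add_right hm _)
    (by simpa [mul_assoc] using h3)) (by simp)

/-- An atom with commuting terms would leave at least six free terms. Otherwise set aside two
non-commuting terms `g`, `h`; among the rest is a product-one `l` with complement `r`. Since `G`
modulo its centre is abelian, `g h r` and `h g r` have central products. These are distinct and the
centre has order 2, so one of them is 1 and the atom splits. -/
theorem not_hasAtom_seven_of_card_eight [Finite G] (hcard : Nat.card G = 8)
    (hnc : ¬ ∀ a b : G, a * b = b * a) : ¬ HasAtom G 7 := by
  have p2 : Fact (Nat.Prime 2) := ⟨Nat.prime_two⟩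
  have hZ := four_mul_card_center_le hnc
  have : Nontrivial G := Finite.one_lt_card_iff_nontrivial.1 (by omega)
  have hcn := (IsPGroup.of_card (p := 2) (n := 3) hcard).center_nontrivial
  have hZ1 := Finite.one_lt_card_iff_nontrivial.2 hcn
  have hN : Nat.card (Subgroup.center G) = 2 := by omega
  have hQ : Nat.card (G ⧸ Subgroup.center G) = 4 := by
    have := (Subgroup.center G).card_eq_card_quotient_mul_card_subgroup
    rw [hN, hcard] at this
    omega
  have hsq : ∀ q : G ⧸ Subgroup.center G, q ^ 2 = 1 := by
    intro q
    have hd : orderOf q ∣ 2 ^ 2 := by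
      have := orderOf_dvd_natCard q
      rwa [hQ] at this
    obtain ⟨j, hj, hqj⟩ := (Nat.dvd_prime_pow Nat.prime_two).1 hd
    rw [← orderOf_dvd_iff_pow_eq_one, hqj]
    interval_cases j
    · norm_num
    · norm_num
    · have := isCyclic_of_orderOf_eq_card q (by rw [hqj, hQ]; rfl)
      exact absurd (MonoidHom.isMulCommutative_of_isCyclic_of_ker_le_center
        (QuotientGroup.mk' (Subgroup.center G)) (by simp)).is_comm.comm hnc
  have hfree := not_hasFree_five hN hQ hsq
  rintro ⟨S, hS, hSc⟩
  by_cases hcomm : ∀ a ∈ S, ∀ b ∈ S, Commute a b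
  · obtain ⟨u, hu⟩ := Multiset.exists_mem_of_ne_zero hS.1
    obtain ⟨A, rfl⟩ := Multiset.exists_cons_of_mem hu
    rw [Multiset.card_cons] at hSc
    exact hfree (HasFree.mono ⟨A, hS.isProductOneFree_of_cons hcomm, rfl⟩ (by omega))
  · push Not at hcomm
    obtain ⟨g, hg, h, hh, hgh⟩ := hcomm
    obtain ⟨R, rfl⟩ := Multiset.exists_cons_of_mem hg
    have hhR : h ∈ R := by
      rcases Multiset.mem_cons.1 hh with rfl | hh
      · exact absurd (Commute.refl h) hgh
      · exact hh
    obtain ⟨R, rfl⟩ := Multiset.exists_cons_of_mem hhR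
    rw [Multiset.card_cons, Multiset.card_cons] at hSc
    have hR : ¬ IsProductOneFree R := fun hR => hfree (HasFree.mono ⟨R, hR, rfl⟩ (by omega))
    rw [isProductOneFree_iff] at hR
    push Not at hR
    obtain ⟨l, hl, hl1, hl0⟩ := hR
    obtain ⟨R', rfl⟩ := Multiset.le_iff_exists_add.1 hl
    induction R' using Quotient.inductionOn with
    | h r =>
      have hw : g * h * r.prod ∈ Subgroup.center G := by
        obtain ⟨s, hs, hs1⟩ := hS.2.1
        have hp : s.Perm (g :: h :: (l ++ r)) := Multiset.coe_eq_coe.1 hs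
        have h1 := prod_eq_of_perm (hp.map (QuotientGroup.mk' (Subgroup.center G)))
          (fun a _ b _ => mul_comm_of_sq_eq_one hsq a b)
        rw [← map_list_prod, ← map_list_prod, hs1, map_one] at h1
        rw [← QuotientGroup.eq_one_iff]
        simpa [hl1, mul_assoc] using h1.symm
      have hw' : h * g * r.prod ∈ Subgroup.center G := by
        rw [← QuotientGroup.eq_one_iff] at hw ⊢
        rw [← hw]
        simp only [QuotientGroup.mk_mul]
        rw [mul_comm_of_sq_eq_one hsq (h : G ⧸ Subgroup.center G)]
      have hprod : IsProductOne (g ::ₘ h ::ₘ (r : Multiset G)) := by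
        by_cases h1 : g * h * r.prod = 1
        · exact isProductOne_coe (l := g :: h :: r) (by simpa [mul_assoc] using h1)
        by_cases h2 : h * g * r.prod = 1
        · rw [Multiset.cons_swap]
          exact isProductOne_coe (l := h :: g :: r) (by simpa [mul_assoc] using h2)
        have h3 := mul_eq_one_of_card_eq_two hN hw (Subgroup.inv_mem _ hw') h1
          (inv_ne_one.2 h2)
        rw [mul_inv_eq_one] at h3
        exact absurd (mul_right_cancel h3) hgh
      rcases hS.2.2 (g ::ₘ h ::ₘ (r : Multiset G)) l (by
        rw [Multiset.cons_add, Multiset.cons_add, add_comm]; rfl) hprod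
        (isProductOne_coe hl1) with h0 | h0
      · simp at h0
      · exact hl0 (by simpa using h0)

theorem hasAtom_six_of_card_eight [Finite G] (hcard : Nat.card G = 8)
    (hnc : ¬ ∀ a b : G, a * b = b * a) : HasAtom G 6 := by
  have hZ := four_mul_card_center_le hnc
  obtain ⟨a, ha⟩ := exists_orderOf_eq_four hcard hnc
  exact hasAtom_of_isMulCommutative (hasFree_zpowers (g := a) (k := 3) (by omega)) (by omega)

/-! ### Abelian groups with `D = 6` -/

theorem exists_orderOf_eq_mul (hc : ∀ a b : G, a * b = b * a) [Finite G] {p q : ℕ}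
    [Fact p.Prime] [Fact q.Prime] (hpq : p ≠ q) (hp : p ∣ Nat.card G) (hq : q ∣ Nat.card G) :
    ∃ g : G, orderOf g = p * q := by
  obtain ⟨a, ha⟩ := exists_prime_orderOf_dvd_card' p hp
  obtain ⟨b, hb⟩ := exists_prime_orderOf_dvd_card' q hq
  have hco : (orderOf a).Coprime (orderOf b) := by
    rw [ha, hb]
    exact (Nat.coprime_primes Fact.out Fact.out).2 hpq
  exact ⟨a * b, by
    rw [(show Commute a b from hc a b).orderOf_mul_eq_mul_orderOf_of_coprime hco, ha, hb]⟩

theorem nonempty_mulEquiv_C {n : ℕ} (hcard : Nat.card G = n) {g : G} (hg : orderOf g = n)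
    [Finite G] : Nonempty (G ≃* C n) := by
  have := isCyclic_of_orderOf_eq_card g (by rw [hg, hcard])
  subst hcard
  exact ⟨(zmodCyclicMulEquiv this).symm⟩

theorem sq_eq_one_or_of_sq_mem [Finite G] {a g : G} (ha : orderOf a = 4) (hg : g ^ 4 = 1)
    (h : g ^ 2 ∈ Subgroup.zpowers a) : g ^ 2 = 1 ∨ g ^ 2 = a ^ 2 := by
  obtain ⟨k, hk, hak⟩ := exists_pow_eq_of_mem_zpowers h
  have h2 : orderOf a ∣ k * 2 := by
    refine orderOf_dvd_of_pow_eq_one ?_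
    rw [pow_mul, hak, ← pow_mul, hg]
  rw [ha] at hk h2
  interval_cases k
  · exact Or.inl (by simpa using hak.symm)
  · omega
  · exact Or.inr hak.symm
  · omega

theorem not_hasFree_five_of_card_eight [Finite G] (hc : ∀ a b : G, a * b = b * a)
    (hcard : Nat.card G = 8) (hG : ¬ HasFree G 6) : ¬ HasFree G 5 := by
  have p2 : Fact (Nat.Prime 2) := ⟨Nat.prime_two⟩
  have hord := sq_eq_one_or_orderOf_eq_four (n := 3) hcard hG
  by_cases hex : ∃ a : G, orderOf a = 4
  · obtain ⟨a, ha⟩ := hex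
    have hidx : (Subgroup.zpowers a).index = 2 := by
      have := (Subgroup.zpowers a).card_mul_index
      rw [Nat.card_zpowers, ha, hcard] at this
      omega
    set N := Subgroup.zpowers (a ^ 2)
    have hnorm : N.Normal := ⟨fun n hn g => by rwa [hc g, mul_inv_cancel_right]⟩
    have hN : Nat.card N = 2 := by
      rw [Nat.card_zpowers, orderOf_pow, ha]
      rfl
    refine not_hasFree_five hN ?_ ?_
    · have := N.card_eq_card_quotient_mul_card_subgroup
      rw [hN, hcard] at this
      omega
    · intro q
      obtain ⟨g, rfl⟩ := QuotientGroup.mk_surjective q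
      rw [← QuotientGroup.mk_pow, QuotientGroup.eq_one_iff]
      have hg4 : g ^ 4 = 1 := by
        rcases hord g with h | h
        · rw [pow_mul g 2 2, h, one_pow]
        · rw [← h, pow_orderOf_eq_one]
      rcases sq_eq_one_or_of_sq_mem ha hg4 (Subgroup.sq_mem_of_index_two hidx g) with h | h
      · rw [h]; exact N.one_mem
      · rw [h]; exact Subgroup.mem_zpowers _
  · push Not at hex
    obtain ⟨φ⟩ := nonempty_mulEquiv_pi (p := 2) (r := 3) hc
      (fun x => (hord x).resolve_right (hex x)) hcard
    intro h
    have := (h.map φ.toMonoidHom φ.injective).le_of_elementary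
    omega

theorem nonempty_mulEquiv_of_card_sixteen [Finite G] (hc : ∀ a b : G, a * b = b * a)
    (hcard : Nat.card G = 16) (hG : ¬ HasFree G 6) {a : G} (ha : orderOf a = 4) :
    Nonempty (G ≃* C 2 × C 2 × C 4) := by
  have hord := sq_eq_one_or_orderOf_eq_four (n := 4) hcard hG
  have ha4 : a ^ 4 = 1 := ha ▸ pow_orderOf_eq_one a
  have hg4 : ∀ g : G, g ^ 4 = 1 := by
    intro g
    rcases hord g with h | h
    · rw [pow_mul g 2 2, h, one_pow]
    · rw [← h, pow_orderOf_eq_one]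
  -- Otherwise the quotient by the powers of `a` has an element of order 4, and 3 + 3 free terms
  -- result.
  have hsq : ∀ g : G, g ^ 2 ∈ Subgroup.zpowers a := by
    intro g
    by_contra h
    have hnorm : (Subgroup.zpowers a).Normal :=
      ⟨fun n hn g => by rwa [hc g, mul_inv_cancel_right]⟩
    have hq : orderOf (g : G ⧸ Subgroup.zpowers a) = 2 ^ 2 := by
      have p2 : Fact (Nat.Prime 2) := ⟨Nat.prime_two⟩
      refine orderOf_eq_prime_pow (n := 1) ?_ ?_
      · rwa [pow_one, ← QuotientGroup.mk_pow, QuotientGroup.eq_one_iff]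
      · rw [← QuotientGroup.mk_pow, QuotientGroup.eq_one_iff, show 2 ^ (1 + 1) = 4 from rfl, hg4]
        exact Subgroup.one_mem _
    exact hG ((hasFree_zpowers (g := a) (k := 3) (by omega)).of_quotient
      (hasFree_of_lt_orderOf (g := (g : G ⧸ Subgroup.zpowers a)) (k := 3) (by rw [hq]; norm_num)))
  -- If `g ^ 2 = a ^ 2`, multiplying `g` by `a` kills the square. So every coset of the powers of
  -- `a` has a representative of square 1, which supplies the two factors `C 2`.
  have hadj : ∀ g : G, g ^ 2 = 1 ∨ (g * a) ^ 2 = 1 := by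
    intro g
    refine (sq_eq_one_or_of_sq_mem ha (hg4 g) (hsq g)).imp_right fun h => ?_
    rw [(show Commute g a from hc g a).mul_pow, h, ← pow_add, ha4]
  -- These products take at most 8 values, while `G` has 16 elements.
  have hlt : ∀ b : G, ∃ c : G, ∀ i : ZMod 2, ∀ k : ZMod 4, c ≠ b ^ i.val * a ^ k.val := by
    intro b
    by_contra! h
    have hsurj : Function.Surjective (fun x : ZMod 2 × ZMod 4 => b ^ x.1.val * a ^ x.2.val) := by
      intro c
      obtain ⟨i, k, hik⟩ := h c
      exact ⟨(i, k), hik.symm⟩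
    have := Nat.card_le_card_of_surjective _ hsurj
    rw [hcard, Nat.card_prod, Nat.card_zmod, Nat.card_zmod] at this
    omega
  have hadj' : ∀ b : G, ∃ c : G, c ^ 2 = 1 ∧
      ∀ i : ZMod 2, ∀ k : ZMod 4, c ≠ b ^ i.val * a ^ k.val := by
    intro b
    obtain ⟨c, hcb⟩ := hlt b
    rcases hadj c with h | h
    · exact ⟨c, h, hcb⟩
    · refine ⟨c * a, h, fun i k hik => hcb i (k - 1) ?_⟩
      have h1 : a ^ k.val = a ^ (k - 1).val * a := by
        conv_lhs => rw [← sub_add_cancel k 1, pow_val_add ha4]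
        congr 1
        exact pow_one a
      rw [h1, ← mul_assoc] at hik
      exact mul_right_cancel hik
  -- With 1 in the role of `b`, the statement supplies an element outside the powers of `a`.
  obtain ⟨b, hb2, hb⟩ := hadj' 1
  obtain ⟨c, hc2, hcb⟩ := hadj' b
  let φ : C 2 × C 2 × C 4 →* G :=
    { toFun := fun x => c ^ x.1.toAdd.val * (b ^ x.2.1.toAdd.val * a ^ x.2.2.toAdd.val)
      map_one' := by simp
      map_mul' := by
        rintro ⟨i, j, k⟩ ⟨i', j', k'⟩
        simp only [Prod.mk_mul_mk, toAdd_mul]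
        rw [pow_val_add hc2, pow_val_add hb2, pow_val_add ha4]
        let _ : CommGroup G := { ‹Group G› with mul_comm := hc }
        rw [mul_mul_mul_comm (b ^ _), mul_mul_mul_comm (c ^ _)] }
  have hinj : Function.Injective φ := by
    rw [injective_iff_map_eq_one]
    rintro ⟨i, j, k⟩ h
    change c ^ (Multiplicative.toAdd i).val * (b ^ (Multiplicative.toAdd j).val *
      a ^ (Multiplicative.toAdd k).val) = 1 at h
    have h01 : ∀ i : ZMod 2, i = 0 ∨ i = 1 := by decide
    rcases h01 (Multiplicative.toAdd i) with hi | hi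
    · rw [hi, ZMod.val_zero, pow_zero, one_mul] at h
      rcases h01 (Multiplicative.toAdd j) with hj | hj
      · rw [hj, ZMod.val_zero, pow_zero, one_mul] at h
        have hk := pow_val_eq_one ha h
        exact Prod.ext hi (Prod.ext hj hk)
      · rw [hj, ZMod.val_one, pow_one, mul_eq_one_iff_eq_inv, ← pow_val_neg ha4] at h
        exact absurd (by simpa using h) (hb 0 (-Multiplicative.toAdd k))
    · rw [hi, ZMod.val_one, pow_one, mul_eq_one_iff_eq_inv, hc, mul_inv_rev, ← pow_val_neg ha4,
        ← pow_val_neg hb2] at h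
      exact absurd h (by simpa using hcb _ _)
  exact ⟨(MulEquiv.ofBijective φ ((Nat.bijective_iff_injective_and_card φ).2
    ⟨hinj, by simp [hcard]⟩)).symm⟩

theorem nonempty_mulEquiv_of_comm [Finite G] (hc : ∀ a b : G, a * b = b * a) (h6 : HasAtom G 6)
    (h7 : ¬ HasAtom G 7) :
    Nonempty (G ≃* C 6) ∨ Nonempty (G ≃* C 2 × C 2 × C 4) ∨ Nonempty (G ≃* (Fin 5 → C 2)) := by
  have p2 : Fact (Nat.Prime 2) := ⟨Nat.prime_two⟩
  have p3 : Fact (Nat.Prime 3) := ⟨Nat.prime_three⟩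
  have p5 : Fact (Nat.Prime 5) := ⟨Nat.prime_five⟩
  have hfree : ¬ HasFree G 6 := fun h => h7 h.hasAtom
  have hfree5 : HasFree G 5 := h6.hasFree hc
  have hle := h6.le_card
  have h12 : ∀ a, 2 ≤ a → Nat.card G ≠ 3 * 2 ^ a := fun a ha h =>
    (hasFree_or_hasAtom_of_card_eq_three_mul ha h).elim hfree h7
  -- This excludes the elementary abelian groups of orders 9 and 16, where `d = 4`.
  have helem : ∀ p r [Fact p.Prime], r * (p - 1) < 5 → Nat.card G = p ^ r →
      ¬ ∀ x : G, x ^ p = 1 := by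
    intro p r _ hlt h hx
    obtain ⟨φ⟩ := nonempty_mulEquiv_pi hc hx h
    have := (hfree5.map φ.toMonoidHom φ.injective).le_of_elementary
    omega
  rcases card_of_not_hasFree_six hfree with h | ⟨h, hx⟩
  · simp only [Finset.mem_insert, Finset.mem_singleton] at h
    rcases h with h | h | h | h | h | h | h | h | h | h | h | h | h
    · omega
    · omega
    · omega
    · omega
    · omega
    · obtain ⟨g, hg⟩ := exists_orderOf_eq_mul hc (p := 2) (q := 3) (by norm_num)
        (h ▸ by norm_num) (h ▸ by norm_num)
      exact Or.inl (nonempty_mulEquiv_C h hg)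
    · exact absurd hfree5 (not_hasFree_five_of_card_eight hc h hfree)
    · refine absurd (fun x => ?_) (helem 3 2 (by norm_num) h)
      have hd : orderOf x ∣ 3 ^ 2 := by
        have := orderOf_dvd_natCard x
        rwa [h] at this
      obtain ⟨j, hj, hxj⟩ := (Nat.dvd_prime_pow Nat.prime_three).1 hd
      rw [← orderOf_dvd_iff_pow_eq_one, hxj]
      interval_cases j
      · norm_num
      · norm_num
      · exact absurd (hasFree_of_lt_orderOf (g := x) (k := 6) (by rw [hxj]; norm_num)) hfree
    · obtain ⟨g, hg⟩ := exists_orderOf_eq_mul hc (p := 2) (q := 5) (by norm_num)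
        (h ▸ by norm_num) (h ▸ by norm_num)
      exact absurd (hasFree_of_lt_orderOf (g := g) (by omega)) hfree
    · exact absurd h (h12 2 le_rfl)
    · obtain ⟨a, ha⟩ : ∃ a : G, orderOf a = 4 := by
        by_contra! hno
        exact helem 2 4 (by norm_num) h
          fun x => (sq_eq_one_or_orderOf_eq_four (n := 4) h hfree x).resolve_right (hno x)
      exact Or.inr (Or.inl (nonempty_mulEquiv_of_card_sixteen hc h hfree ha))
    · obtain ⟨g, hg⟩ := exists_orderOf_eq_mul hc (p := 2) (q := 3) (by norm_num)
        (h ▸ by norm_num) (h ▸ by norm_num)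
      refine absurd (hasFree_succ_of_lt_orderOf (g := g) (k := 5) (by omega) fun ht => ?_) hfree
      have := Nat.card_zpowers g
      rw [ht, Nat.card_congr Subgroup.topEquiv.toEquiv] at this
      omega
    · exact absurd h (h12 3 (by norm_num))
  · exact Or.inr (Or.inr (nonempty_mulEquiv_pi (r := 5) hc hx (by rw [h]; norm_num)))

/-! ### The large Davenport constants of the six groups -/

theorem hasAtom_congr (e : G ≃* H) (k : ℕ) : HasAtom G k ↔ HasAtom H k :=
  ⟨fun h => h.map e.toMonoidHom e.injective, fun h => h.map e.symm.toMonoidHom e.symm.injective⟩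

theorem hasFree_congr (e : G ≃* H) (k : ℕ) : HasFree G k ↔ HasFree H k :=
  ⟨fun h => h.map e.toMonoidHom e.injective, fun h => h.map e.symm.toMonoidHom e.symm.injective⟩

theorem largeDavenport_C_six : largeDavenport (C 6) = 6 := by
  have hcard : Nat.card (C 6) = 6 := Nat.card_zmod 6
  refine (largeDavenport_eq_iff (k := 6) (by norm_num)).2 ⟨?_, fun h => ?_⟩
  · have ho : orderOf (Multiplicative.ofAdd (1 : ZMod 6)) = 6 := by
      rw [orderOf_ofAdd_eq_addOrderOf, ZMod.addOrderOf_one]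
    exact (hasFree_of_lt_orderOf (g := Multiplicative.ofAdd (1 : ZMod 6)) (k := 5)
      (by omega)).hasAtom
  · have := h.le_card
    omega

theorem not_hasFree_C_two_C_two_C_four : ¬ HasFree (C 2 × C 2 × C 4) 6 := by
  have hx : ∀ x : C 2 × C 2 × C 4, x =
      (Multiplicative.ofAdd 1, 1, 1) ^ x.1.toAdd.val *
      (1, Multiplicative.ofAdd 1, 1) ^ x.2.1.toAdd.val *
      (1, 1, Multiplicative.ofAdd 1) ^ x.2.2.toAdd.val := by decide
  -- Generators of orders 2, 2 and 4 give the Olson bound 1 + 1 + 3 = 5.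
  have hg : ∀ i ∈ (Finset.univ : Finset (Fin 3)), (![(Multiplicative.ofAdd 1, 1, 1),
      (1, Multiplicative.ofAdd 1, 1), (1, 1, Multiplicative.ofAdd 1)] : Fin 3 → C 2 × C 2 × C 4) i ^
        2 ^ (![1, 1, 2] : Fin 3 → ℕ) i = 1 := by decide
  have p2 : Fact (Nat.Prime 2) := ⟨Nat.prime_two⟩
  intro h
  have := h.le_sum _ _ _ hg (by
    rw [Subgroup.eq_top_iff']
    intro x
    rw [hx x]
    refine mul_mem (mul_mem (pow_mem (Subgroup.subset_closure ?_) _)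
      (pow_mem (Subgroup.subset_closure ?_) _)) (pow_mem (Subgroup.subset_closure ?_) _)
    · exact ⟨0, by simp, rfl⟩
    · exact ⟨1, by simp, rfl⟩
    · exact ⟨2, by simp, rfl⟩)
  simp [Fin.sum_univ_three] at this

theorem largeDavenport_C_two_C_two_C_four : largeDavenport (C 2 × C 2 × C 4) = 6 := by
  have hcard : Nat.card (C 2 × C 2 × C 4) = 2 ^ 4 := by simp
  refine (largeDavenport_eq_iff (k := 6) (by norm_num)).2
    ⟨?_, fun h => not_hasFree_C_two_C_two_C_four (h.hasFree mul_comm)⟩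
  have ho : orderOf ((1, 1, Multiplicative.ofAdd 1) : C 2 × C 2 × C 4) = 4 := by
    rw [Prod.orderOf_mk, Prod.orderOf_mk, orderOf_ofAdd_eq_addOrderOf, ZMod.addOrderOf_one]
    simp
  exact (hasFree_of_card_eq_two_pow hcard ho).hasAtom

theorem hasFree_elementary_five : HasFree (Fin 5 → C 2) 5 := by
  have p2 : Fact (Nat.Prime 2) := ⟨Nat.prime_two⟩
  exact hasFree_of_card_eq_prime_pow (p := 2) (n := 5) (by simp)

theorem not_hasFree_elementary_six : ¬ HasFree (Fin 5 → C 2) 6 := by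
  have p2 : Fact (Nat.Prime 2) := ⟨Nat.prime_two⟩
  intro h
  have := h.le_of_elementary
  omega

theorem largeDavenport_elementary_five : largeDavenport (Fin 5 → C 2) = 6 :=
  (largeDavenport_eq_iff (k := 6) (by norm_num)).2 ⟨hasFree_elementary_five.hasAtom,
    fun h => not_hasFree_elementary_six (h.hasFree mul_comm)⟩

theorem largeDavenport_dihedralGroup_three : largeDavenport (DihedralGroup 3) = 6 := by
  refine (largeDavenport_eq_iff (k := 6) (by norm_num)).2 ⟨?_, fun h => ?_⟩
  · exact hasAtom_six_of_order_three (r := .r 1) (x := .sr 0) (by decide) (by decide) (by decide)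
      (by decide)
  · have := h.le_card
    rw [DihedralGroup.nat_card] at this
    omega

theorem largeDavenport_of_card_eight [Finite G] (hcard : Nat.card G = 8)
    (hnc : ¬ ∀ a b : G, a * b = b * a) : largeDavenport G = 6 :=
  (largeDavenport_eq_iff (k := 6) (by norm_num)).2
    ⟨hasAtom_six_of_card_eight hcard hnc, not_hasAtom_seven_of_card_eight hcard hnc⟩

theorem largeDavenport_dihedralGroup_four : largeDavenport (DihedralGroup 4) = 6 :=
  largeDavenport_of_card_eight DihedralGroup.nat_card
    fun h => absurd (h (.sr 0) (.r 1)) (by decide)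

theorem largeDavenport_quaternionGroup_two : largeDavenport (QuaternionGroup 2) = 6 :=
  largeDavenport_of_card_eight (by rw [Nat.card_eq_fintype_card, QuaternionGroup.card])
    fun h => absurd (h (.xa 0) (.a 1)) (by decide)

theorem largeDavenport_congr (e : G ≃* H) : largeDavenport G = largeDavenport H := by
  refine ENat.eq_of_forall_natCast_le_iff fun k => ?_
  rcases Nat.eq_zero_or_pos k with rfl | hk
  · simp
  · rw [le_largeDavenport_iff hk, le_largeDavenport_iff hk, hasAtom_congr e]

theorem largeDavenport_eq_six_of_mulEquiv
    (h : Nonempty (G ≃* C 6) ∨ Nonempty (G ≃* C 2 × C 2 × C 4) ∨ Nonempty (G ≃* (Fin 5 → C 2)) ∨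
      Nonempty (G ≃* DihedralGroup 3) ∨ Nonempty (G ≃* QuaternionGroup 2) ∨
      Nonempty (G ≃* DihedralGroup 4)) : largeDavenport G = 6 := by
  rcases h with ⟨⟨e⟩⟩ | ⟨⟨e⟩⟩ | ⟨⟨e⟩⟩ | ⟨⟨e⟩⟩ | ⟨⟨e⟩⟩ | ⟨⟨e⟩⟩ <;> rw [largeDavenport_congr e]
  exacts [largeDavenport_C_six, largeDavenport_C_two_C_two_C_four,
    largeDavenport_elementary_five, largeDavenport_dihedralGroup_three,
    largeDavenport_quaternionGroup_two, largeDavenport_dihedralGroup_four]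

end GroupSequence

theorem lemma4p6 (G : Type*) [Group G] [Finite G] :
    (32 ≤ Nat.card G →
      (Nonempty (G ≃* (Fin 5 → GroupSequence.C 2)) ∧ GroupSequence.smallDavenport G = 5) ∨
        6 ≤ GroupSequence.smallDavenport G) ∧
    (GroupSequence.largeDavenport G = 6 ↔
      Nonempty (G ≃* GroupSequence.C 6) ∨
      Nonempty (G ≃* GroupSequence.C 2 × GroupSequence.C 2 × GroupSequence.C 4) ∨
      Nonempty (G ≃* (Fin 5 → GroupSequence.C 2)) ∨
      Nonempty (G ≃* DihedralGroup 3) ∨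
      Nonempty (G ≃* QuaternionGroup 2) ∨
      Nonempty (G ≃* DihedralGroup 4)) ∧
    (GroupSequence.largeDavenport G ≤ 5 → ∀ a b : G, a * b = b * a) := by
  open GroupSequence in
  have p2 : Fact (Nat.Prime 2) := ⟨Nat.prime_two⟩
  refine ⟨fun hcard => ?_, ⟨fun h => ?_, largeDavenport_eq_six_of_mulEquiv⟩, fun h => ?_⟩
  · by_cases h6 : HasFree G 6
    · exact Or.inr ((le_smallDavenport_iff (k := 6) (by norm_num)).2 h6)
    · rcases card_of_not_hasFree_six h6 with h | ⟨h, hx⟩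
      · have : ∀ n ∈ ({1, 2, 3, 4, 5, 6, 8, 9, 10, 12, 16, 18, 24} : Finset ℕ), n < 32 := by decide
        exact absurd (this _ h) (by omega)
      · obtain ⟨e⟩ := nonempty_mulEquiv_pi (p := 2) (r := 5) (mul_comm_of_sq_eq_one hx) hx
          (by rw [h]; norm_num)
        exact Or.inl ⟨⟨e⟩, (smallDavenport_eq_iff (k := 5) (by norm_num)).2
          ⟨(hasFree_congr e 5).2 hasFree_elementary_five, h6⟩⟩
  · obtain ⟨h6, h7⟩ := (largeDavenport_eq_iff (k := 6) (by norm_num)).1 h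
    by_cases hc : ∀ a b : G, a * b = b * a
    · rcases nonempty_mulEquiv_of_comm hc h6 h7 with h | h | h <;> simp [h]
    · rcases nonempty_mulEquiv_of_not_hasAtom hc h7 with h | h | h <;> simp [h]
  -- A non-abelian group without an atom of length at least 7 is one of three groups with `D = 6`,
  -- so `D ≤ 5` is impossible.
  · by_contra hc
    have h7 : ¬ HasAtom G 7 := by
      intro h7
      have h1 := ((le_largeDavenport_iff (k := 7) (by norm_num)).2 h7).trans h
      exact absurd h1 (by decide)
    have h6 : largeDavenport G = 6 := by
      apply largeDavenport_eq_six_of_mulEquiv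
      rcases nonempty_mulEquiv_of_not_hasAtom hc h7 with h | h | h <;> simp [h]
    rw [h6] at h
    exact absurd h (by decide)
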